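/- Let $\alpha\in(1,2)$ and let $X$ be a totally asymmetric $\alpha$-stable random variable, namely a real random variable with characteristic function $$\mathbb{E}\,e^{itX}=\exp\left(\int_{0}^{\infty}\left(e^{itx}-1-itx\right)\frac{dx}{x^{\alpha+1}}\right),\qquad t\in\mathbb{R}.$$ For every $y\in\left[\frac{2}{\sqrt{2-\alpha}},\frac{1}{2-\alpha}\right]$ one has $$\mathbb{P}\left(X\ge 2y-\frac{1}{\alpha-1}\right)\le\frac{2}{e}\,\frac{1}{y^{\alpha}}+e^{\frac14}e^{-\frac12(2-\alpha)y^{2}}$$ and $$\mathbb{P}\left(X\ge \frac14 y-\frac{1}{\alpha-1}\right)\ge\frac{1}{400\sqrt{e}}\left(e^{-1}\frac{1}{y^{\alpha}}+e^{-(2-\alpha)y^{2}}\right).$$ For every $y\ge\frac{1}{2-\alpha}$ one has $$\mathbb{P}\left(X\ge 2y-\frac{1}{\alpha-1}\right)\le\frac{8}{y^{\alpha}}\qquad\text{and}\qquad \mathbb{P}\left(X\ge y-\frac{1}{\alpha-1}\right)\ge 10^{-3}\,\frac{1}{y^{\alpha}}.$$ -/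

import Mathlib

open MeasureTheory ProbabilityTheory

/-- The exponent `∫₀^∞ (e^{itx} - 1 - itx) x^{-α-1} dx`. For `1 < α < 2` the integrand is
absolutely integrable for every real `t`. -/
noncomputable def stableExponent (α t : ℝ) : ℂ :=
  ∫ x in Set.Ioi (0 : ℝ),
    (Complex.exp (Complex.I * (t * x : ℝ)) - 1 - Complex.I * (t * x : ℝ)) / ((x ^ (α + 1) : ℝ) : ℂ)

/-- `X` is a real random variable on `(Ω, P)` with the totally asymmetric `α`-stable law
(`1 < α < 2`, Lévy measure `x^{-α-1} dx` on `(0, ∞)`, centred): its characteristic function is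
`t ↦ exp (∫₀^∞ (e^{itx} - 1 - itx) x^{-α-1} dx)`. -/
structure IsTotallyAsymmetricStable {Ω : Type*} [MeasurableSpace Ω] (P : Measure Ω)
    (α : ℝ) (X : Ω → ℝ) : Prop where
  aemeasurable : AEMeasurable X P
  charFun_eq : ∀ t : ℝ, charFun (P.map X) t = Complex.exp (stableExponent α t)

open Filter Topology

/-! ### Compound Poisson laws -/

section Conv

variable {𝕜 : Type*} [RCLike 𝕜] {μ ν : Measure ℝ} {f : ℝ → 𝕜}

/-! The stable law is the weak limit, as `δ → 0`, of `truncatedStable α δ R`, an independent sum of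
centred compound Poisson variables with jumps in `(δ, R]` and in `(R, ∞)`. The limit does not depend
on `R`, so each estimate may choose its own cutoff. Jumps above `R` have total mass `1 / (α R ^ α)`
and mean `R ^ (1 - α) / (α - 1)`; for `R = 1` this mean is the shift `1 / (α - 1)` in the theorem.

Upper bounds (`stable_tail_le`) take `R = y`. Either a jump exceeds `y`, which costs `1 / (α y ^
α)`, or the small jumps alone reach the level, which Chernoff's inequality controls.
`laplaceExponent_le` splits their exponent into a Gaussian part of variance `1 / (2 - α)` at unit
cutoff and a cubic remainder. The choice `u = α log y` balances `exp u` against `y ^ α`, while `u`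
proportional to `(2 - α) y ^ 2` is suited to the Gaussian part; `exists_chernoff_parameter` decides
between them.

Lower bounds (`le_stable_tail`) take `R = 1`. The power term comes from one jump of size at least
`3y`, while the rest stays above `-2y` (`le_stable_tail_rpow`). The Gaussian term comes from a
Paley–Zygmund argument for `exp (l x)` under the small jumps, with no large jump
(`le_stable_tail_gaussian`). -/

theorem integrable_conv_of_map_add [SFinite ν] (hf : Measurable f) (hadd : ∀ x y, f (x + y) = f x * f y)
    (hμ : Integrable f μ) (hν : Integrable f ν) : Integrable f (μ.conv ν) := by
  rw [Measure.conv, integrable_map_measure hf.aestronglyMeasurable (by fun_prop)]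
  refine (hμ.mul_prod hν).congr (.of_forall fun x => ?_)
  simp [hadd]

theorem integral_conv_of_map_add [SFinite μ] [SFinite ν] (hf : Measurable f) (hadd : ∀ x y, f (x + y) = f x * f y) :
    ∫ x, f x ∂(μ.conv ν) = (∫ x, f x ∂μ) * ∫ x, f x ∂ν := by
  rw [Measure.conv, integral_map (by fun_prop) hf.aestronglyMeasurable, ← integral_prod_mul]
  simp [hadd]

end Conv

/-- The `k`-fold convolution power of a measure on `ℝ`. -/
noncomputable def convPow (ν : Measure ℝ) : ℕ → Measure ℝ
  | 0 => Measure.dirac 0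
  | k + 1 => (convPow ν k).conv ν

/-- The compound Poisson law with finite Lévy measure `ν`. -/
noncomputable def compoundPoisson (ν : Measure ℝ) : Measure ℝ :=
  Measure.sum fun k : ℕ =>
    ENNReal.ofReal (Real.exp (-ν.real Set.univ) / k.factorial) • convPow ν k

section CompoundPoisson

variable {ν : Measure ℝ} [IsFiniteMeasure ν]

instance (k : ℕ) : IsFiniteMeasure (convPow ν k) := by
  induction k with
  | zero => unfold convPow; infer_instance
  | succ k ih => unfold convPow; infer_instance

theorem integrable_convPow {𝕜 : Type*} [RCLike 𝕜] {f : ℝ → 𝕜} (hf : Measurable f)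
    (hadd : ∀ x y, f (x + y) = f x * f y) (hν : Integrable f ν) (k : ℕ) :
    Integrable f (convPow ν k) := by
  induction k with
  | zero => exact integrable_dirac (by simp)
  | succ k ih => exact integrable_conv_of_map_add hf hadd ih hν

theorem integral_convPow {𝕜 : Type*} [RCLike 𝕜] {f : ℝ → 𝕜} (hf : Measurable f)
    (hadd : ∀ x y, f (x + y) = f x * f y) (h0 : f 0 = 1) (k : ℕ) :
    ∫ x, f x ∂(convPow ν k) = (∫ x, f x ∂ν) ^ k := by
  induction k with
  | zero => simp [convPow, h0]
  | succ k ih => rw [convPow, integral_conv_of_map_add hf hadd, ih, pow_succ]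

/-- A multiplicative `f` turns convolution powers into powers of one integral, so the compound
Poisson sum becomes an exponential series. Characters give the characteristic function and real
exponentials the Laplace transform. -/
theorem integrable_compoundPoisson {f : ℝ → ℂ} (hf : Measurable f)
    (hadd : ∀ x y, f (x + y) = f x * f y) (h0 : f 0 = 1) (hν : Integrable f ν) :
    Integrable f (compoundPoisson ν) := by
  refine integrable_sum_measure
    (fun k => (integrable_convPow hf hadd hν k).smul_measure (by simp)) ?_
  -- The norm of `f` is again multiplicative, hence the same formula applies over `ℝ`.
  have key : ∀ k, ∫ x, ‖f x‖ ∂(convPow ν k) = (∫ x, ‖f x‖ ∂ν) ^ k :=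
    integral_convPow (𝕜 := ℝ) (f := fun x => ‖f x‖) hf.norm (fun x y => by simp [hadd])
      (by simp [h0])
  simp only [integral_smul_measure, key, smul_eq_mul]
  refine ((Real.summable_pow_div_factorial (∫ x, ‖f x‖ ∂ν)).mul_left
    (Real.exp (-ν.real Set.univ))).congr fun k => ?_
  rw [ENNReal.toReal_ofReal (by positivity)]
  ring

theorem integral_compoundPoisson {f : ℝ → ℂ} (hf : Measurable f)
    (hadd : ∀ x y, f (x + y) = f x * f y) (h0 : f 0 = 1) (hν : Integrable f ν) :
    ∫ x, f x ∂(compoundPoisson ν) = Complex.exp (∫ x, (f x - 1) ∂ν) := by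
  have h1 := hasSum_integral_measure (integrable_compoundPoisson hf hadd h0 hν)
  have h2 : HasSum (fun k : ℕ => Complex.exp (-ν.real Set.univ) *
      ((∫ x, f x ∂ν) ^ k / (k.factorial : ℂ)))
      (Complex.exp (-ν.real Set.univ) * Complex.exp (∫ x, f x ∂ν)) := by
    have h := NormedSpace.expSeries_div_hasSum_exp (∫ x, f x ∂ν)
    rw [← Complex.exp_eq_exp_ℂ] at h
    exact h.mul_left _
  rw [integral_sub hν (integrable_const _)]
  simp only [integral_const, Complex.real_smul, mul_one]
  rw [sub_eq_neg_add, Complex.exp_add]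
  refine h1.unique (h2.congr_fun fun k => ?_)
  rw [integral_smul_measure, integral_convPow hf hadd h0,
    ENNReal.toReal_ofReal (by positivity), Complex.real_smul]
  push_cast
  ring

instance : IsProbabilityMeasure (compoundPoisson ν) := by
  have h1 : Integrable (fun _ : ℝ => (1 : ℂ)) (compoundPoisson ν) :=
    integrable_compoundPoisson measurable_const (by simp) rfl (integrable_const _)
  have hfin : IsFiniteMeasure (compoundPoisson ν) := by
    rcases integrable_const_iff.1 h1 with h | h
    · simp at h
    · exact h
  have h2 := integral_compoundPoisson (ν := ν) (f := fun _ => 1) measurable_const (by simp) rfl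
    (integrable_const _)
  simp only [integral_const, Complex.real_smul, mul_one, sub_self, mul_zero, Complex.exp_zero] at h2
  have h3 : (compoundPoisson ν).real Set.univ = 1 := by exact_mod_cast h2
  exact ⟨by rw [← ENNReal.toReal_eq_one_iff]; exact h3⟩

theorem charFun_compoundPoisson (t : ℝ) :
    charFun (compoundPoisson ν) t = Complex.exp (∫ x, (Complex.exp (t * x * Complex.I) - 1) ∂ν) := by
  rw [charFun_apply_real]
  refine integral_compoundPoisson (by fun_prop) (fun x y => ?_) (by simp) ?_
  · rw [← Complex.exp_add]; push_cast; ring_nf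
  · refine (integrable_const (1 : ℝ)).mono' (by fun_prop) (.of_forall fun x => ?_)
    rw [← Complex.ofReal_mul, Complex.norm_exp_ofReal_mul_I]

theorem integrable_exp_mul_compoundPoisson {l : ℝ}
    (h : Integrable (fun x => Real.exp (l * x)) ν) :
    Integrable (fun x => Real.exp (l * x)) (compoundPoisson ν) := by
  have := integrable_compoundPoisson (ν := ν) (f := fun x => (Real.exp (l * x) : ℂ)) (by fun_prop)
    (fun x y => by rw [mul_add, Real.exp_add]; push_cast; rfl) (by simp) h.ofReal
  exact this.re

theorem mgf_compoundPoisson {l : ℝ} (h : Integrable (fun x => Real.exp (l * x)) ν) :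
    mgf id (compoundPoisson ν) l = Real.exp (∫ x, (Real.exp (l * x) - 1) ∂ν) := by
  have := integral_compoundPoisson (ν := ν) (f := fun x => (Real.exp (l * x) : ℂ)) (by fun_prop)
    (fun x y => by rw [mul_add, Real.exp_add]; push_cast; rfl) (by simp) h.ofReal
  have h2 : ∀ x : ℝ, ((Real.exp (l * x) : ℂ) - 1) = ((Real.exp (l * x) - 1 : ℝ) : ℂ) := by
    intro x; push_cast; rfl
  simp only [h2] at this
  rw [integral_complex_ofReal, integral_complex_ofReal, ← Complex.ofReal_exp] at this
  exact_mod_cast this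

theorem le_compoundPoisson_zero (s : Set ℝ) (hs : (0 : ℝ) ∈ s) :
    Real.exp (-ν.real Set.univ) ≤ (compoundPoisson ν).real s := by
  have h : ENNReal.ofReal (Real.exp (-ν.real Set.univ)) ≤ compoundPoisson ν s := by
    refine le_trans ?_ (Measure.le_sum_apply _ s)
    refine le_trans ?_ (ENNReal.le_tsum 0)
    simp [convPow, hs]
  exact (ENNReal.ofReal_le_iff_le_toReal (measure_ne_top _ _)).1 h

theorem le_compoundPoisson_one (s : Set ℝ) :
    Real.exp (-ν.real Set.univ) * ν.real s ≤ (compoundPoisson ν).real s := by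
  have h : ENNReal.ofReal (Real.exp (-ν.real Set.univ) * ν.real s) ≤ compoundPoisson ν s := by
    refine le_trans ?_ (Measure.le_sum_apply _ s)
    refine le_trans ?_ (ENNReal.le_tsum 1)
    rw [ENNReal.ofReal_mul (by positivity)]
    simp [convPow, Measure.dirac_zero_conv]
  exact (ENNReal.ofReal_le_iff_le_toReal (measure_ne_top _ _)).1 h

/-- A nonzero value requires at least one jump, and `1 - exp (-m) ≤ m`. -/
theorem compoundPoisson_compl_zero_le :
    (compoundPoisson ν).real {0}ᶜ ≤ ν.real Set.univ := by
  rw [measureReal_compl (measurableSet_singleton 0), probReal_univ]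
  have h1 := le_compoundPoisson_zero (ν := ν) {0} rfl
  have h2 := Real.add_one_le_exp (-ν.real Set.univ)
  linarith

end CompoundPoisson

/-! ### Tails of convolutions -/

section Tails

variable {μ ν : Measure ℝ} [IsProbabilityMeasure μ] [IsProbabilityMeasure ν]

theorem mul_le_conv_Ici (s t : ℝ) :
    μ.real (Set.Ici s) * ν.real (Set.Ici t) ≤ (μ.conv ν).real (Set.Ici (s + t)) := by
  rw [← measureReal_prod_prod, Measure.conv, map_measureReal_apply (by fun_prop) measurableSet_Ici]
  refine measureReal_mono fun x hx => ?_
  simp only [Set.mem_prod, Set.mem_Ici, Set.mem_preimage] at hx ⊢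
  linarith

theorem conv_Ici_le (s : ℝ) :
    (μ.conv ν).real (Set.Ici s) ≤ μ.real (Set.Ici s) + ν.real {0}ᶜ := by
  rw [Measure.conv, map_measureReal_apply (by fun_prop) measurableSet_Ici]
  calc (μ.prod ν).real ((fun x : ℝ × ℝ => x.1 + x.2) ⁻¹' Set.Ici s)
      ≤ (μ.prod ν).real (Set.Ici s ×ˢ Set.univ ∪ Set.univ ×ˢ {0}ᶜ) := by
        refine measureReal_mono fun x hx => ?_
        by_cases h : x.2 = 0
        · left; simpa [h] using hx
        · right; simpa using h
    _ ≤ _ := by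
        refine (measureReal_union_le _ _).trans ?_
        rw [measureReal_prod_prod, measureReal_prod_prod]
        simp

/-- A linearised Paley–Zygmund inequality: integrate `e ≤ exp (l s) + τ e ^ 2 + 1 / (4 τ)` with `e =
exp (l x)`, where the last term is needed only for `x ≥ s`. Optimising `τ` gives the usual quotient,
but a fixed `τ` keeps the bound affine in the two Laplace transforms. -/
theorem le_real_Ici_of_mgf {l s τ : ℝ} (hl : 0 ≤ l) (hτ : 0 < τ)
    (h1 : Integrable (fun x => Real.exp (l * x)) μ)
    (h2 : Integrable (fun x => Real.exp (2 * l * x)) μ) :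
    4 * τ * (mgf id μ l - Real.exp (l * s) - τ * mgf id μ (2 * l)) ≤ μ.real (Set.Ici s) := by
  have hpt : ∀ x, Real.exp (l * x) ≤ Real.exp (l * s) + τ * Real.exp (2 * l * x)
      + (Set.Ici s).indicator (fun _ => 1 / (4 * τ)) x := by
    intro x
    by_cases hx : x ∈ Set.Ici s
    · rw [Set.indicator_of_mem hx, show 2 * l * x = l * x + l * x by ring, Real.exp_add]
      have h3 : τ * (Real.exp (l * x) * Real.exp (l * x)) + 1 / (4 * τ) - Real.exp (l * x)
          = (2 * τ * Real.exp (l * x) - 1) ^ 2 / (4 * τ) := by field_simp; ring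
      have h4 : 0 ≤ (2 * τ * Real.exp (l * x) - 1) ^ 2 / (4 * τ) := by positivity
      have := Real.exp_pos (l * s)
      linarith
    · rw [Set.indicator_of_notMem hx]
      have : Real.exp (l * x) ≤ Real.exp (l * s) :=
        Real.exp_le_exp.2 (mul_le_mul_of_nonneg_left (not_le.1 hx).le hl)
      have := Real.exp_pos (2 * l * x)
      nlinarith
  have hi : Integrable ((Set.Ici s).indicator (fun _ => 1 / (4 * τ))) μ :=
    (integrable_const _).indicator measurableSet_Ici
  have hi' : Integrable (fun x => Real.exp (l * s) + τ * Real.exp (2 * l * x)) μ :=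
    (integrable_const _).add (h2.const_mul τ)
  have h := integral_mono h1 (hi'.add hi) hpt
  simp only [Pi.add_apply] at h
  rw [integral_add hi' hi,
    integral_add (integrable_const _) (h2.const_mul τ), integral_const_mul,
    integral_indicator measurableSet_Ici] at h
  simp only [integral_const, probReal_univ, measureReal_restrict_apply_univ,
    smul_eq_mul] at h
  simp only [mgf, id]
  set p := μ.real (Set.Ici s)
  have h5 : p * (1 / (4 * τ)) * (4 * τ) = p := by field_simp
  nlinarith

end Tails

/-! ### Centred compound Poisson laws -/

/-- The compound Poisson law with Lévy measure `ν`, shifted to have mean zero. -/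
noncomputable def centeredPoisson (ν : Measure ℝ) : Measure ℝ :=
  (compoundPoisson ν).conv (Measure.dirac (-∫ x, x ∂ν))

section CenteredPoisson

variable {ν : Measure ℝ} [IsFiniteMeasure ν]

instance : IsProbabilityMeasure (centeredPoisson ν) := by
  unfold centeredPoisson; infer_instance

theorem charFun_centeredPoisson (hν : Integrable (fun x => x) ν) (t : ℝ) :
    charFun (centeredPoisson ν) t = Complex.exp
      (∫ x, (Complex.exp (Complex.I * (t * x : ℝ)) - 1 - Complex.I * (t * x : ℝ)) ∂ν) := by
  have h1 : Integrable (fun x : ℝ => Complex.exp (Complex.I * (t * x : ℝ)) - 1) ν := by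
    refine Integrable.sub ?_ (integrable_const _)
    refine (integrable_const (1 : ℝ)).mono' (by fun_prop) (.of_forall fun x => ?_)
    rw [mul_comm, Complex.norm_exp_ofReal_mul_I]
  have h2 : Integrable (fun x : ℝ => Complex.I * (t * x : ℝ)) ν :=
    ((hν.const_mul t).ofReal (𝕜 := ℂ)).const_mul _
  have h3 : ∫ x : ℝ, Complex.I * (t * x : ℝ) ∂ν = Complex.I * (t * (∫ x, x ∂ν) : ℝ) := by
    rw [integral_const_mul, integral_complex_ofReal, integral_const_mul]
  rw [integral_sub h1 h2, h3, centeredPoisson, charFun_conv, charFun_compoundPoisson,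
    charFun_dirac, ← Complex.exp_add]
  congr 1
  rw [sub_eq_add_neg]
  congr 1
  · congr 1 with x
    push_cast
    ring_nf
  · simp
    ring

theorem integrable_exp_mul_centeredPoisson {l : ℝ}
    (h : Integrable (fun x => Real.exp (l * x)) ν) :
    Integrable (fun x => Real.exp (l * x)) (centeredPoisson ν) :=
  integrable_conv_of_map_add (by fun_prop) (fun x y => by rw [mul_add, Real.exp_add])
    (integrable_exp_mul_compoundPoisson h) (integrable_dirac (by simp))

theorem mgf_centeredPoisson (hν : Integrable (fun x => x) ν) {l : ℝ}
    (h : Integrable (fun x => Real.exp (l * x)) ν) :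
    mgf id (centeredPoisson ν) l = Real.exp (∫ x, (Real.exp (l * x) - 1 - l * x) ∂ν) := by
  have h1 : mgf id (centeredPoisson ν) l
      = mgf id (compoundPoisson ν) l * Real.exp (l * -∫ x, x ∂ν) := by
    simp only [mgf, id, centeredPoisson]
    rw [integral_conv_of_map_add (f := fun x => Real.exp (l * x)) (by fun_prop)
      (fun x y => by rw [mul_add, Real.exp_add]), integral_dirac]
  have h2 : Integrable (fun x => Real.exp (l * x) - 1) ν := h.sub (integrable_const _)
  rw [h1, mgf_compoundPoisson h, ← Real.exp_add, integral_sub h2 (hν.const_mul l),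
    integral_const_mul]
  congr 1
  ring

theorem conv_dirac_real_Ici (μ : Measure ℝ) [SFinite μ] (c s : ℝ) :
    (μ.conv (Measure.dirac c)).real (Set.Ici s) = μ.real (Set.Ici (s - c)) := by
  rw [Measure.conv_dirac, map_measureReal_apply (by fun_prop) measurableSet_Ici]
  congr 1
  ext x
  simp

theorem conv_centeredPoisson_real_Ici (μ : Measure ℝ) [IsProbabilityMeasure μ] (s : ℝ) :
    (μ.conv (centeredPoisson ν)).real (Set.Ici s)
      = (μ.conv (compoundPoisson ν)).real (Set.Ici (s + ∫ x, x ∂ν)) := by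
  rw [centeredPoisson, ← Measure.conv_assoc, conv_dirac_real_Ici, sub_neg_eq_add]

end CenteredPoisson

/-! ### The stable Lévy measure -/

/-- The restriction of the Lévy measure `x^{-α-1} dx` to `s`. -/
noncomputable def stableLevy (α : ℝ) (s : Set ℝ) : Measure ℝ :=
  (volume.restrict s).withDensity fun x => ENNReal.ofReal (1 / x ^ (α + 1))

section StableLevy

variable {α : ℝ} {s : Set ℝ} {E : Type*} [NormedAddCommGroup E] [NormedSpace ℝ E]

theorem toReal_stable_density_ae (hs : MeasurableSet s) (hs0 : s ⊆ Set.Ioi 0) :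
    ∀ᵐ x ∂(volume.restrict s),
      (ENNReal.ofReal (1 / x ^ (α + 1))).toReal = 1 / x ^ (α + 1) := by
  filter_upwards [ae_restrict_mem hs] with x hx
  have : 0 < x := hs0 hx
  rw [ENNReal.toReal_ofReal (by positivity)]

theorem integrable_stableLevy_iff (hs : MeasurableSet s) (hs0 : s ⊆ Set.Ioi 0) {f : ℝ → E} :
    Integrable f (stableLevy α s) ↔ IntegrableOn (fun x => (1 / x ^ (α + 1)) • f x) s := by
  rw [stableLevy, integrable_withDensity_iff_integrable_smul' (by fun_prop) (by simp)]
  refine integrable_congr ?_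
  filter_upwards [toReal_stable_density_ae (α := α) hs hs0] with x hx
  rw [hx]

theorem integral_stableLevy (hs : MeasurableSet s) (hs0 : s ⊆ Set.Ioi 0) (f : ℝ → E) :
    ∫ x, f x ∂(stableLevy α s) = ∫ x in s, (1 / x ^ (α + 1)) • f x := by
  rw [stableLevy, integral_withDensity_eq_integral_toReal_smul (by fun_prop) (by simp)]
  refine integral_congr_ae ?_
  filter_upwards [toReal_stable_density_ae (α := α) hs hs0] with x hx
  rw [hx]

theorem stableLevy_mono {s t : Set ℝ} (h : s ⊆ t) : stableLevy α s ≤ stableLevy α t := by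
  refine Measure.le_iff.2 fun A hA => ?_
  rw [stableLevy, stableLevy, withDensity_apply _ hA, withDensity_apply _ hA]
  exact lintegral_mono' (Measure.restrict_mono le_rfl (Measure.restrict_mono_set _ h)) le_rfl

theorem one_div_rpow_eq {x : ℝ} (hx : 0 < x) (p : ℝ) : 1 / x ^ p = x ^ (-p) := by
  rw [Real.rpow_neg hx.le, one_div]

theorem one_div_rpow_mul_pow {x : ℝ} (hx : 0 < x) (p : ℝ) (k : ℕ) :
    1 / x ^ p * x ^ k = x ^ (k - p) := by
  rw [Real.rpow_sub hx, Real.rpow_natCast]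
  ring

theorem integrable_const_stableLevy_Ioi (hα : 1 < α) {R : ℝ} (hR : 0 < R) :
    Integrable (fun _ => (1 : ℝ)) (stableLevy α (Set.Ioi R)) := by
  rw [integrable_stableLevy_iff measurableSet_Ioi (Set.Ioi_subset_Ioi hR.le)]
  refine (integrableOn_Ioi_rpow_of_lt (a := -(α + 1)) (by linarith) hR).congr_fun
    (fun x hx => ?_) measurableSet_Ioi
  simp only [one_div_rpow_eq (hR.trans hx), smul_eq_mul, mul_one]

theorem isFiniteMeasure_stableLevy_Ioi (hα : 1 < α) {R : ℝ} (hR : 0 < R) :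
    IsFiniteMeasure (stableLevy α (Set.Ioi R)) := by
  rcases integrable_const_iff.1 (integrable_const_stableLevy_Ioi hα hR) with h | h
  · simp at h
  · exact h

theorem isFiniteMeasure_stableLevy_Ioc (hα : 1 < α) {δ : ℝ} (hδ : 0 < δ) (R : ℝ) :
    IsFiniteMeasure (stableLevy α (Set.Ioc δ R)) := by
  have := isFiniteMeasure_stableLevy_Ioi hα hδ
  exact isFiniteMeasure_of_le _ (stableLevy_mono Set.Ioc_subset_Ioi_self)

theorem stableLevy_real_univ_Ioi (hα : 1 < α) {R : ℝ} (hR : 0 < R) :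
    (stableLevy α (Set.Ioi R)).real Set.univ = 1 / (α * R ^ α) := by
  have h1 : ∫ _, (1 : ℝ) ∂(stableLevy α (Set.Ioi R)) = (stableLevy α (Set.Ioi R)).real Set.univ := by
    simp
  rw [← h1, integral_stableLevy measurableSet_Ioi (Set.Ioi_subset_Ioi hR.le)]
  have h2 : ∫ x in Set.Ioi R, (1 / x ^ (α + 1)) • (1 : ℝ) = ∫ x in Set.Ioi R, x ^ (-(α + 1)) := by
    refine setIntegral_congr_fun measurableSet_Ioi fun x hx => ?_
    simp only [one_div_rpow_eq (hR.trans hx), smul_eq_mul, mul_one]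
  rw [h2, integral_Ioi_rpow_of_lt (by linarith) hR, show -(α + 1) + 1 = -α by ring,
    Real.rpow_neg hR.le]
  field_simp

theorem integrable_id_stableLevy_Ioi (hα : 1 < α) {R : ℝ} (hR : 0 < R) :
    Integrable (fun x => x) (stableLevy α (Set.Ioi R)) := by
  rw [integrable_stableLevy_iff measurableSet_Ioi (Set.Ioi_subset_Ioi hR.le)]
  refine (integrableOn_Ioi_rpow_of_lt (a := (1 : ℕ) - (α + 1)) (by push_cast; linarith) hR).congr_fun
    (fun x hx => ?_) measurableSet_Ioi
  simp only [← one_div_rpow_mul_pow (hR.trans hx), smul_eq_mul, pow_one]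

theorem integral_id_stableLevy_Ioi (hα : 1 < α) {R : ℝ} (hR : 0 < R) :
    ∫ x, x ∂(stableLevy α (Set.Ioi R)) = R ^ (1 - α) / (α - 1) := by
  rw [integral_stableLevy measurableSet_Ioi (Set.Ioi_subset_Ioi hR.le)]
  have h2 : ∫ x in Set.Ioi R, (1 / x ^ (α + 1)) • x
      = ∫ x in Set.Ioi R, x ^ (((1 : ℕ) : ℝ) - (α + 1)) := by
    refine setIntegral_congr_fun measurableSet_Ioi fun x hx => ?_
    simp only [← one_div_rpow_mul_pow (hR.trans hx), smul_eq_mul, pow_one]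
  rw [h2, integral_Ioi_rpow_of_lt (by push_cast; linarith) hR,
    show ((1 : ℕ) : ℝ) - (α + 1) + 1 = 1 - α by push_cast; ring, neg_div, ← div_neg, neg_sub]

theorem integrable_id_stableLevy_Ioc (hα : 1 < α) {δ : ℝ} (hδ : 0 < δ) (R : ℝ) :
    Integrable (fun x => x) (stableLevy α (Set.Ioc δ R)) :=
  (integrable_id_stableLevy_Ioi hα hδ).mono_measure (stableLevy_mono Set.Ioc_subset_Ioi_self)

theorem ae_mem_stableLevy (hs : MeasurableSet s) : ∀ᵐ x ∂(stableLevy α s), x ∈ s :=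
  (withDensity_absolutelyContinuous _ _).ae_le (ae_restrict_mem hs)

theorem integrable_exp_stableLevy_Ioc (hα : 1 < α) {δ : ℝ} (hδ : 0 < δ) (R l : ℝ) :
    Integrable (fun x => Real.exp (l * x)) (stableLevy α (Set.Ioc δ R)) := by
  have := isFiniteMeasure_stableLevy_Ioc hα hδ R
  refine (integrable_const (Real.exp (|l| * R))).mono' (by fun_prop) ?_
  filter_upwards [ae_mem_stableLevy measurableSet_Ioc] with x hx
  have hx0 : 0 < x := hδ.trans hx.1
  rw [Real.norm_eq_abs, Real.abs_exp]
  refine Real.exp_le_exp.2 ?_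
  calc l * x ≤ |l| * x := by gcongr; exact le_abs_self l
    _ ≤ |l| * R := by gcongr; exact hx.2

theorem le_stableLevy_Ioi_real_Ici (hα : 1 < α) {R t : ℝ} (hR : 0 < R) (ht : R ≤ t) :
    1 / (α * t ^ α) ≤ (stableLevy α (Set.Ioi R)).real (Set.Ici t) := by
  have := isFiniteMeasure_stableLevy_Ioi hα hR
  rw [← stableLevy_real_univ_Ioi hα (hR.trans_le ht)]
  refine ENNReal.toReal_mono (measure_ne_top _ _) (le_trans (measure_mono_ae ?_)
    (stableLevy_mono (Set.Ioi_subset_Ioi ht) _))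
  filter_upwards [ae_mem_stableLevy (α := α) (measurableSet_Ioi (a := t))] with x hx _
  exact Set.mem_Ici.2 (Set.mem_Ioi.1 hx).le

end StableLevy

/-! ### Weak approximation of the stable law -/

section Exponent

variable {α : ℝ}

theorem norm_exp_I_mul_sub_one_sub_le (u : ℝ) :
    ‖Complex.exp (Complex.I * u) - 1 - Complex.I * u‖ ≤ 2 * |u| := by
  calc ‖Complex.exp (Complex.I * u) - 1 - Complex.I * u‖
      ≤ ‖Complex.exp (Complex.I * u) - 1‖ + ‖Complex.I * u‖ := norm_sub_le _ _
    _ ≤ |u| + |u| := by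
        refine add_le_add Real.norm_exp_I_mul_ofReal_sub_one_le (le_of_eq ?_)
        simp
    _ = 2 * |u| := by ring

theorem norm_exp_I_mul_sub_one_sub_le_sq (u : ℝ) :
    ‖Complex.exp (Complex.I * u) - 1 - Complex.I * u‖ ≤ 2 * u ^ 2 := by
  have hn : ‖Complex.I * (u : ℂ)‖ = |u| := by simp
  rcases le_total |u| 1 with h | h
  · have := Complex.norm_exp_sub_one_sub_id_le (x := Complex.I * u) (by rw [hn]; exact h)
    rw [hn, sq_abs] at this
    nlinarith [sq_nonneg u]
  · have := norm_exp_I_mul_sub_one_sub_le u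
    rw [← sq_abs]
    nlinarith

theorem integrableOn_Ioc_rpow {p : ℝ} (hp : -1 < p) {R : ℝ} (hR : 0 ≤ R) :
    IntegrableOn (fun x : ℝ => x ^ p) (Set.Ioc 0 R) :=
  (intervalIntegrable_iff_integrableOn_Ioc_of_le hR).1 (intervalIntegral.intervalIntegrable_rpow' hp)

theorem integral_Ioc_rpow {p : ℝ} (hp : -1 < p) {R : ℝ} (hR : 0 ≤ R) :
    ∫ x in Set.Ioc 0 R, x ^ p = R ^ (p + 1) / (p + 1) := by
  rw [← intervalIntegral.integral_of_le hR, integral_rpow (Or.inl hp),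
    Real.zero_rpow (by linarith), sub_zero]

theorem integrableOn_stableExponent (hα1 : 1 < α) (hα2 : α < 2) (t : ℝ) :
    IntegrableOn (fun x : ℝ => (1 / x ^ (α + 1)) •
      (Complex.exp (Complex.I * (t * x : ℝ)) - 1 - Complex.I * (t * x : ℝ))) (Set.Ioi 0) := by
  have hm : Measurable (fun x : ℝ => (1 / x ^ (α + 1)) •
      (Complex.exp (Complex.I * (t * x : ℝ)) - 1 - Complex.I * (t * x : ℝ))) := by fun_prop
  -- The quadratic bound is integrable at `0` because `α < 2`, the linear one at infinity because `1
  -- < α`.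
  rw [← Set.Ioc_union_Ioi_eq_Ioi (zero_le_one' ℝ)]
  refine IntegrableOn.union ?_ ?_
  · refine ((integrableOn_Ioc_rpow (p := (2 : ℕ) - (α + 1)) (by push_cast; linarith)
      zero_le_one).const_mul (2 * t ^ 2)).mono' hm.aestronglyMeasurable ?_
    filter_upwards [ae_restrict_mem measurableSet_Ioc] with x hx
    have hx0 : 0 < x := hx.1
    rw [norm_smul, Real.norm_of_nonneg (by positivity), ← one_div_rpow_mul_pow hx0]
    calc 1 / x ^ (α + 1) * _ ≤ 1 / x ^ (α + 1) * (2 * (t * x) ^ 2) := by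
          gcongr; exact norm_exp_I_mul_sub_one_sub_le_sq _
      _ = _ := by ring
  · refine ((integrableOn_Ioi_rpow_of_lt (a := (1 : ℕ) - (α + 1)) (by push_cast; linarith)
      zero_lt_one).const_mul (2 * |t|)).mono' hm.aestronglyMeasurable ?_
    filter_upwards [ae_restrict_mem measurableSet_Ioi] with x hx
    have hx0 : 0 < x := zero_lt_one.trans hx
    rw [norm_smul, Real.norm_of_nonneg (by positivity), ← one_div_rpow_mul_pow hx0]
    calc 1 / x ^ (α + 1) * _ ≤ 1 / x ^ (α + 1) * (2 * |t * x|) := by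
          gcongr; exact norm_exp_I_mul_sub_one_sub_le _
      _ = _ := by rw [abs_mul, abs_of_pos hx0]; ring

theorem stableExponent_eq (α t : ℝ) : stableExponent α t = ∫ x in Set.Ioi (0 : ℝ),
    (1 / x ^ (α + 1)) •
      (Complex.exp (Complex.I * (t * x : ℝ)) - 1 - Complex.I * (t * x : ℝ)) := by
  unfold stableExponent
  congr 1 with x
  rw [Complex.real_smul]
  push_cast
  ring

end Exponent

/-- The law of the centred sum of the jumps in `(δ, R]` and of the centred sum of the jumps in
`(R, ∞)`, all drawn independently with intensity `x^{-α-1} dx`. -/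
noncomputable def truncatedStable (α δ R : ℝ) : Measure ℝ :=
  (centeredPoisson (stableLevy α (Set.Ioc δ R))).conv (centeredPoisson (stableLevy α (Set.Ioi R)))

section Approximation

variable {α : ℝ}

theorem isProbabilityMeasure_truncatedStable (hα : 1 < α) {δ R : ℝ} (hδ : 0 < δ) (hR : 0 < R) :
    IsProbabilityMeasure (truncatedStable α δ R) := by
  have := isFiniteMeasure_stableLevy_Ioc hα hδ R
  have := isFiniteMeasure_stableLevy_Ioi hα hR
  unfold truncatedStable
  infer_instance

theorem charFun_truncatedStable (hα1 : 1 < α) (hα2 : α < 2) {δ R : ℝ} (hδ : 0 < δ) (hR : δ ≤ R)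
    (t : ℝ) : charFun (truncatedStable α δ R) t = Complex.exp (∫ x in Set.Ioi δ,
      (1 / x ^ (α + 1)) •
        (Complex.exp (Complex.I * (t * x : ℝ)) - 1 - Complex.I * (t * x : ℝ))) := by
  have hR0 := hδ.trans_le hR
  have := isFiniteMeasure_stableLevy_Ioc hα1 hδ R
  have := isFiniteMeasure_stableLevy_Ioi hα1 hR0
  have hs1 : Set.Ioc δ R ⊆ Set.Ioi 0 := fun x hx => hδ.trans hx.1
  have hs2 : Set.Ioi R ⊆ Set.Ioi 0 := Set.Ioi_subset_Ioi hR0.le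
  have hint := integrableOn_stableExponent hα1 hα2 t
  rw [truncatedStable, charFun_conv, charFun_centeredPoisson (integrable_id_stableLevy_Ioc hα1 hδ R),
    charFun_centeredPoisson (integrable_id_stableLevy_Ioi hα1 hR0), ← Complex.exp_add,
    integral_stableLevy measurableSet_Ioc hs1, integral_stableLevy measurableSet_Ioi hs2,
    ← setIntegral_union _ measurableSet_Ioi (hint.mono_set hs1) (hint.mono_set hs2),
    Set.Ioc_union_Ioi_eq_Ioi hR]
  exact Set.disjoint_left.2 fun x h1 h2 => not_lt.2 h1.2 h2

theorem tendsto_setIntegral_truncation {E : Type*} [NormedAddCommGroup E] [NormedSpace ℝ E]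
    {f : ℝ → E} {R : ℝ} (hR : 0 < R) {s : Set ℝ} (hs : MeasurableSet s)
    (hf : IntegrableOn f (Set.Ioi 0 ∩ s)) :
    Tendsto (fun n : ℕ => ∫ x in Set.Ioi (R / (n + 1)) ∩ s, f x) atTop
      (𝓝 (∫ x in Set.Ioi 0 ∩ s, f x)) := by
  have hU : (⋃ n : ℕ, Set.Ioi (R / (n + 1)) ∩ s) = Set.Ioi 0 ∩ s := by
    rw [← Set.iUnion_inter]
    congr 1
    ext x
    simp only [Set.mem_iUnion, Set.mem_Ioi]
    constructor
    · rintro ⟨n, hn⟩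
      exact lt_trans (by positivity) hn
    · intro hx
      obtain ⟨n, hn⟩ := exists_nat_gt (R / x)
      refine ⟨n, ?_⟩
      rw [div_lt_iff₀ (by positivity)]
      rw [div_lt_iff₀ hx] at hn
      nlinarith
  rw [← hU] at hf ⊢
  refine tendsto_setIntegral_of_monotone (fun n => measurableSet_Ioi.inter hs) ?_ hf
  intro m n hmn
  refine Set.inter_subset_inter_left _ (Set.Ioi_subset_Ioi ?_)
  have : (m : ℝ) ≤ n := by exact_mod_cast hmn
  gcongr

variable {Ω : Type*} [MeasurableSpace Ω] {P : Measure Ω} {X : Ω → ℝ}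

theorem tendsto_charFun_truncatedStable (hα1 : 1 < α) (hα2 : α < 2)
    (hX : IsTotallyAsymmetricStable P α X) {R : ℝ} (hR : 0 < R) (t : ℝ) :
    Tendsto (fun n : ℕ => charFun (truncatedStable α (R / (n + 1)) R) t) atTop
      (𝓝 (charFun (P.map X) t)) := by
  rw [hX.charFun_eq, stableExponent_eq]
  have h := tendsto_setIntegral_truncation hR MeasurableSet.univ
    (f := fun x : ℝ => (1 / x ^ (α + 1)) •
      (Complex.exp (Complex.I * (t * x : ℝ)) - 1 - Complex.I * (t * x : ℝ)))
    (by rw [Set.inter_univ]; exact integrableOn_stableExponent hα1 hα2 t)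
  simp only [Set.inter_univ] at h
  refine ((Complex.continuous_exp.tendsto _).comp h).congr fun n => ?_
  rw [charFun_truncatedStable hα1 hα2 (by positivity) (div_le_self hR.le (by simp))]
  rfl

theorem real_setOf_ge (hX : IsTotallyAsymmetricStable P α X) (b : ℝ) :
    P.real {ω | X ω ≥ b} = (P.map X).real (Set.Ici b) := by
  rw [map_measureReal_apply_of_aemeasurable hX.aemeasurable measurableSet_Ici]
  rfl

/-- Portmanteau for the closed half-line: lower bounds pass to the limit at the same threshold. -/
theorem le_real_of_forall_truncatedStable [IsProbabilityMeasure P] (hα1 : 1 < α) (hα2 : α < 2)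
    (hX : IsTotallyAsymmetricStable P α X) {R : ℝ} (hR : 0 < R) {b q : ℝ} {p : ℕ → ℝ}
    (hp : Tendsto p atTop (𝓝 q))
    (h : ∀ n : ℕ, p n ≤ (truncatedStable α (R / (n + 1)) R).real (Set.Ici b)) :
    q ≤ P.real {ω | X ω ≥ b} := by
  have hprob : ∀ n : ℕ, IsProbabilityMeasure (truncatedStable α (R / (n + 1)) R) := fun n =>
    isProbabilityMeasure_truncatedStable hα1 (by positivity) hR
  have : IsProbabilityMeasure (P.map X) := Measure.isProbabilityMeasure_map hX.aemeasurable
  have hlim := ProbabilityMeasure.tendsto_iff_tendsto_charFun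
    (μ := fun n : ℕ => ⟨truncatedStable α (R / (n + 1)) R, hprob n⟩) (μ₀ := ⟨P.map X, this⟩) |>.2
    (tendsto_charFun_truncatedStable hα1 hα2 hX hR)
  have h1 := ProbabilityMeasure.limsup_measure_closed_le_of_tendsto hlim (isClosed_Ici (a := b))
  have h2 : Tendsto (fun n => ENNReal.ofReal (p n)) atTop (𝓝 (ENNReal.ofReal q)) :=
    ENNReal.tendsto_ofReal hp
  rw [real_setOf_ge hX]
  refine (ENNReal.ofReal_le_iff_le_toReal (measure_ne_top _ _)).1 ?_
  rw [← h2.limsup_eq]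
  refine le_trans (limsup_le_limsup (.of_forall fun n => ?_)) h1
  exact (ENNReal.ofReal_le_iff_le_toReal
    (measure_ne_top (truncatedStable α (R / (n + 1)) R) _)).2 (h n)

/-- Portmanteau bounds only open sets from above, so the estimate is assumed at every threshold `c`;
continuity of `f` then lets `c` increase to `b`. This avoids proving that the limit law has no
atoms. -/
theorem real_le_of_forall_truncatedStable [IsProbabilityMeasure P] (hα1 : 1 < α) (hα2 : α < 2)
    (hX : IsTotallyAsymmetricStable P α X) {R : ℝ} (hR : 0 < R) {f : ℝ → ℝ} (hf : Continuous f)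
    (b : ℝ) (h : ∀ (n : ℕ) (c : ℝ), (truncatedStable α (R / (n + 1)) R).real (Set.Ici c) ≤ f c) :
    P.real {ω | X ω ≥ b} ≤ f b := by
  have hprob : ∀ n : ℕ, IsProbabilityMeasure (truncatedStable α (R / (n + 1)) R) := fun n =>
    isProbabilityMeasure_truncatedStable hα1 (by positivity) hR
  have : IsProbabilityMeasure (P.map X) := Measure.isProbabilityMeasure_map hX.aemeasurable
  have hlim := ProbabilityMeasure.tendsto_iff_tendsto_charFun
    (μ := fun n : ℕ => ⟨truncatedStable α (R / (n + 1)) R, hprob n⟩) (μ₀ := ⟨P.map X, this⟩) |>.2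
    (tendsto_charFun_truncatedStable hα1 hα2 hX hR)
  rw [real_setOf_ge hX]
  have key : ∀ c < b, (P.map X).real (Set.Ici b) ≤ f c := by
    intro c hc
    have h1 := ProbabilityMeasure.le_liminf_measure_open_of_tendsto hlim (isOpen_Ioi (a := c))
    have hf0 : 0 ≤ f c := measureReal_nonneg.trans (h 0 c)
    refine (ENNReal.toReal_le_of_le_ofReal hf0 ?_)
    refine (measure_mono (Set.Ici_subset_Ioi.2 hc)).trans (h1.trans ?_)
    refine liminf_le_of_frequently_le' (Eventually.frequently (.of_forall fun n => ?_))
    refine (measure_mono Set.Ioi_subset_Ici_self).trans ?_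
    exact (ENNReal.le_ofReal_iff_toReal_le
      (measure_ne_top (truncatedStable α (R / (n + 1)) R) _) hf0).2 (h n c)
  exact ge_of_tendsto (hf.continuousWithinAt (s := Set.Iio b))
    (eventually_nhdsWithin_of_forall key)

end Approximation

/-! ### Exponential moments of the jumps of size at most `R` -/

section ExpRemainder

theorem hasSum_exp_sub_quadratic (u : ℝ) :
    HasSum (fun k : ℕ => u ^ (k + 3) / ((k + 3).factorial : ℝ))
      (Real.exp u - 1 - u - u ^ 2 / 2) := by
  have h := NormedSpace.expSeries_div_hasSum_exp u
  rw [← Real.exp_eq_exp_ℝ, ← hasSum_nat_add_iff' 3] at h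
  have h2 : Real.exp u - ∑ i ∈ Finset.range 3, u ^ i / (i.factorial : ℝ)
      = Real.exp u - 1 - u - u ^ 2 / 2 := by
    simp [Finset.sum_range_succ]
    ring
  rwa [h2] at h

/-- The remainder is a power series with nonnegative terms starting at degree three, so each term
gains at least a factor `s ^ 3`. -/
theorem exp_sub_quadratic_mul_le {s u : ℝ} (hs0 : 0 ≤ s) (hs1 : s ≤ 1) (hu : 0 ≤ u) :
    Real.exp (s * u) - 1 - s * u - (s * u) ^ 2 / 2
      ≤ s ^ 3 * (Real.exp u - 1 - u - u ^ 2 / 2) := by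
  refine hasSum_le (fun k => ?_) (hasSum_exp_sub_quadratic (s * u))
    ((hasSum_exp_sub_quadratic u).mul_left (s ^ 3))
  rw [mul_pow, mul_div_assoc]
  have : s ^ (k + 3) ≤ s ^ 3 := pow_le_pow_of_le_one hs0 hs1 (by omega)
  gcongr

theorem exp_sub_quadratic_nonneg {u : ℝ} (hu : 0 ≤ u) :
    0 ≤ Real.exp u - 1 - u - u ^ 2 / 2 := by
  have := Real.quadratic_le_exp_of_nonneg hu
  linarith

theorem exp_neg_le_quadratic {v : ℝ} (hv : 0 ≤ v) : Real.exp (-v) ≤ 1 - v + v ^ 2 / 2 := by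
  have h := Real.quadratic_le_exp_of_nonneg hv
  rw [Real.exp_neg, inv_le_comm₀ (Real.exp_pos v) (by nlinarith [sq_nonneg (v - 1)])]
  refine le_trans ?_ h
  rw [inv_le_iff_one_le_mul₀ (by nlinarith [sq_nonneg (v - 1)])]
  -- The product `(1 - v + v ^ 2 / 2) (1 + v + v ^ 2 / 2)` equals `1 + v ^ 4 / 4`.
  nlinarith [sq_nonneg (v ^ 2)]

end ExpRemainder

/-- The exponent `∫₀^R (e^{lx} - 1 - lx) x^{-α-1} dx` of the Laplace transform of the centred sum
of the jumps of size at most `R`. -/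
noncomputable def laplaceExponent (α R l : ℝ) : ℝ :=
  ∫ x in Set.Ioc 0 R, 1 / x ^ (α + 1) * (Real.exp (l * x) - 1 - l * x)

section LaplaceExponent

variable {α : ℝ}

theorem laplace_integrand_nonneg {x : ℝ} (hx : 0 < x) (l : ℝ) :
    0 ≤ 1 / x ^ (α + 1) * (Real.exp (l * x) - 1 - l * x) := by
  have := Real.add_one_le_exp (l * x)
  have : 0 ≤ Real.exp (l * x) - 1 - l * x := by linarith
  positivity

theorem laplace_integrand_le {l R x : ℝ} (hl : 0 ≤ l) (hx : x ∈ Set.Ioc 0 R) :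
    1 / x ^ (α + 1) * (Real.exp (l * x) - 1 - l * x)
      ≤ l ^ 2 / 2 * x ^ (((2 : ℕ) : ℝ) - (α + 1))
        + (Real.exp (l * R) - 1 - l * R - (l * R) ^ 2 / 2) / R ^ 3
          * x ^ (((3 : ℕ) : ℝ) - (α + 1)) := by
  have hx0 : 0 < x := hx.1
  have hR : 0 < R := hx0.trans_le hx.2
  have h := exp_sub_quadratic_mul_le (s := x / R) (u := l * R) (by positivity)
    ((div_le_one hR).2 hx.2) (by positivity)
  rw [show x / R * (l * R) = l * x by field_simp] at h
  rw [← one_div_rpow_mul_pow hx0, ← one_div_rpow_mul_pow hx0]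
  calc 1 / x ^ (α + 1) * (Real.exp (l * x) - 1 - l * x)
      ≤ 1 / x ^ (α + 1) * ((l * x) ^ 2 / 2 +
        (x / R) ^ 3 * (Real.exp (l * R) - 1 - l * R - (l * R) ^ 2 / 2)) := by
        gcongr
        linarith
    _ = _ := by ring

theorem laplace_integrand_neg_le {l x : ℝ} (hl : 0 ≤ l) (hx : 0 < x) :
    1 / x ^ (α + 1) * (Real.exp (-l * x) - 1 - -l * x)
      ≤ l ^ 2 / 2 * x ^ (((2 : ℕ) : ℝ) - (α + 1)) := by
  rw [← one_div_rpow_mul_pow hx]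
  have h := exp_neg_le_quadratic (v := l * x) (by positivity)
  calc 1 / x ^ (α + 1) * (Real.exp (-l * x) - 1 - -l * x)
      ≤ 1 / x ^ (α + 1) * ((l * x) ^ 2 / 2) := by
        gcongr
        rw [neg_mul]
        linarith
    _ = _ := by ring

theorem integrableOn_laplace (hα2 : α < 2) {R : ℝ} (hR : 0 ≤ R) (l : ℝ) :
    IntegrableOn (fun x => 1 / x ^ (α + 1) * (Real.exp (l * x) - 1 - l * x)) (Set.Ioc 0 R) := by
  have hm : Measurable fun x : ℝ => 1 / x ^ (α + 1) * (Real.exp (l * x) - 1 - l * x) := by fun_prop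
  have h2 := integrableOn_Ioc_rpow (p := ((2 : ℕ) : ℝ) - (α + 1)) (by push_cast; linarith) hR
  have h3 := integrableOn_Ioc_rpow (p := ((3 : ℕ) : ℝ) - (α + 1)) (by push_cast; linarith) hR
  rcases le_total 0 l with hl | hl
  · refine ((h2.const_mul (l ^ 2 / 2)).add (h3.const_mul
      ((Real.exp (l * R) - 1 - l * R - (l * R) ^ 2 / 2) / R ^ 3))).mono' hm.aestronglyMeasurable ?_
    filter_upwards [ae_restrict_mem measurableSet_Ioc] with x hx
    rw [Real.norm_of_nonneg (laplace_integrand_nonneg hx.1 l)]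
    exact laplace_integrand_le hl hx
  · refine (h2.const_mul ((-l) ^ 2 / 2)).mono' hm.aestronglyMeasurable ?_
    filter_upwards [ae_restrict_mem measurableSet_Ioc] with x hx
    rw [Real.norm_of_nonneg (laplace_integrand_nonneg hx.1 l)]
    simpa using laplace_integrand_neg_le (α := α) (neg_nonneg.2 hl) hx.1

/-- Only the quadratic term carries the singular factor `1 / (2 - α)`; the cubic remainder, compared
with `(x / R) ^ 3`, integrates to the harmless `1 / (3 - α)`. -/
theorem laplaceExponent_le (hα2 : α < 2) {R l : ℝ} (hR : 0 < R) (hl : 0 ≤ l) :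
    laplaceExponent α R l ≤ 1 / R ^ α * ((l * R) ^ 2 / (2 * (2 - α))
      + (Real.exp (l * R) - 1 - l * R - (l * R) ^ 2 / 2) / (3 - α)) := by
  have h2 := integrableOn_Ioc_rpow (p := ((2 : ℕ) : ℝ) - (α + 1)) (by push_cast; linarith) hR.le
  have h3 := integrableOn_Ioc_rpow (p := ((3 : ℕ) : ℝ) - (α + 1)) (by push_cast; linarith) hR.le
  have h := setIntegral_mono_on (integrableOn_laplace hα2 hR.le l)
    ((h2.const_mul (l ^ 2 / 2)).add (h3.const_mul
      ((Real.exp (l * R) - 1 - l * R - (l * R) ^ 2 / 2) / R ^ 3)))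
    measurableSet_Ioc (fun x hx => laplace_integrand_le hl hx)
  refine h.trans (le_of_eq ?_)
  simp only [Pi.add_apply]
  rw [integral_add (h2.const_mul _) (h3.const_mul _), integral_const_mul, integral_const_mul,
    integral_Ioc_rpow (by push_cast; linarith) hR.le,
    integral_Ioc_rpow (by push_cast; linarith) hR.le,
    show ((2 : ℕ) : ℝ) - (α + 1) + 1 = (2 : ℕ) - α by ring,
    show ((3 : ℕ) : ℝ) - (α + 1) + 1 = (3 : ℕ) - α by ring,
    ← one_div_rpow_mul_pow hR, ← one_div_rpow_mul_pow hR]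
  have : (2 - α) ≠ 0 := by linarith
  have : (3 - α) ≠ 0 := by linarith
  have : R ^ α ≠ 0 := by positivity
  push_cast
  field_simp

theorem laplaceExponent_one_neg_le (hα2 : α < 2) {l : ℝ} (hl : 0 ≤ l) :
    laplaceExponent α 1 (-l) ≤ l ^ 2 / (2 * (2 - α)) := by
  have h2 := integrableOn_Ioc_rpow (p := ((2 : ℕ) : ℝ) - (α + 1)) (by push_cast; linarith)
    (zero_le_one' ℝ)
  have h := setIntegral_mono_on (integrableOn_laplace hα2 zero_le_one (-l))
    (h2.const_mul (l ^ 2 / 2)) measurableSet_Ioc (fun x hx => laplace_integrand_neg_le hl hx.1)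
  refine h.trans (le_of_eq ?_)
  rw [integral_const_mul, integral_Ioc_rpow (by push_cast; linarith) zero_le_one,
    Real.one_rpow, show ((2 : ℕ) : ℝ) - (α + 1) + 1 = 2 - α by push_cast; ring]
  have : (2 - α) ≠ 0 := by linarith
  field_simp

theorem le_laplaceExponent_one (hα2 : α < 2) {l : ℝ} (hl : 0 ≤ l) :
    l ^ 2 / (2 * (2 - α)) ≤ laplaceExponent α 1 l := by
  have h2 := integrableOn_Ioc_rpow (p := ((2 : ℕ) : ℝ) - (α + 1)) (by push_cast; linarith)
    (zero_le_one' ℝ)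
  have h := setIntegral_mono_on (h2.const_mul (l ^ 2 / 2)) (integrableOn_laplace hα2 zero_le_one l)
    measurableSet_Ioc (fun x hx => ?_)
  · refine (le_of_eq ?_).trans h
    rw [integral_const_mul, integral_Ioc_rpow (by push_cast; linarith) zero_le_one,
      Real.one_rpow, show ((2 : ℕ) : ℝ) - (α + 1) + 1 = 2 - α by push_cast; ring]
    have : (2 - α) ≠ 0 := by linarith
    field_simp
  · have hx0 : 0 < x := hx.1
    have h := exp_sub_quadratic_nonneg (u := l * x) (by positivity)
    rw [← one_div_rpow_mul_pow hx0]
    calc l ^ 2 / 2 * (1 / x ^ (α + 1) * x ^ 2) = 1 / x ^ (α + 1) * ((l * x) ^ 2 / 2) := by ring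
      _ ≤ _ := by gcongr; linarith

theorem mgf_truncation (hα1 : 1 < α) {δ : ℝ} (hδ : 0 < δ) (R l : ℝ) :
    mgf id (centeredPoisson (stableLevy α (Set.Ioc δ R))) l
      = Real.exp (∫ x in Set.Ioc δ R, 1 / x ^ (α + 1) * (Real.exp (l * x) - 1 - l * x)) := by
  have := isFiniteMeasure_stableLevy_Ioc hα1 hδ R
  rw [mgf_centeredPoisson (integrable_id_stableLevy_Ioc hα1 hδ R)
    (integrable_exp_stableLevy_Ioc hα1 hδ R l),
    integral_stableLevy measurableSet_Ioc (fun x hx => hδ.trans hx.1)]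
  rfl

theorem mgf_truncation_le (hα1 : 1 < α) (hα2 : α < 2) {δ R : ℝ} (hδ : 0 < δ) (hR : 0 ≤ R) (l : ℝ) :
    mgf id (centeredPoisson (stableLevy α (Set.Ioc δ R))) l
      ≤ Real.exp (laplaceExponent α R l) := by
  rw [mgf_truncation hα1 hδ]
  refine Real.exp_le_exp.2 (setIntegral_mono_set (integrableOn_laplace hα2 hR l) ?_ ?_)
  · filter_upwards [ae_restrict_mem measurableSet_Ioc] with x hx
    exact laplace_integrand_nonneg hx.1 l
  · exact (Set.Ioc_subset_Ioc_left hδ.le).eventuallyLE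

theorem tendsto_mgf_truncation (hα1 : 1 < α) (hα2 : α < 2) {R : ℝ} (hR : 0 < R) (l : ℝ) :
    Tendsto (fun n : ℕ => mgf id (centeredPoisson (stableLevy α (Set.Ioc (R / (n + 1)) R))) l)
      atTop (𝓝 (Real.exp (laplaceExponent α R l))) := by
  have h := tendsto_setIntegral_truncation hR (measurableSet_Iic (a := R))
    (f := fun x => 1 / x ^ (α + 1) * (Real.exp (l * x) - 1 - l * x))
    (by rw [Set.Ioi_inter_Iic]; exact integrableOn_laplace hα2 hR.le l)
  simp only [Set.Ioi_inter_Iic] at h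
  refine ((Real.continuous_exp.tendsto _).comp h).congr fun n => ?_
  rw [mgf_truncation hα1 (by positivity)]
  rfl

end LaplaceExponent

/-! ### General tail bounds for the stable law -/

section TailBounds

variable {α : ℝ} {Ω : Type*} [MeasurableSpace Ω] {P : Measure Ω} [IsProbabilityMeasure P]
  {X : Ω → ℝ}

/-- The first term is the cost of any jump above `R`. Without such jumps only their negative
compensation remains, which raises the threshold for the small jumps by `R ^ (1 - α) / (α - 1)`. -/
theorem stable_tail_le (hα1 : 1 < α) (hα2 : α < 2) (hX : IsTotallyAsymmetricStable P α X)
    {R l : ℝ} (hR : 0 < R) (hl : 0 ≤ l) (b : ℝ) :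
    P.real {ω | X ω ≥ b} ≤ 1 / (α * R ^ α)
      + Real.exp (laplaceExponent α R l - l * (b + R ^ (1 - α) / (α - 1))) := by
  refine real_le_of_forall_truncatedStable hα1 hα2 hX hR
    (f := fun b => 1 / (α * R ^ α)
      + Real.exp (laplaceExponent α R l - l * (b + R ^ (1 - α) / (α - 1)))) (by fun_prop) b
    fun n c => ?_
  have hδ : 0 < R / (n + 1) := by positivity
  have := isFiniteMeasure_stableLevy_Ioc hα1 hδ R
  have := isFiniteMeasure_stableLevy_Ioi hα1 hR
  rw [truncatedStable, conv_centeredPoisson_real_Ici, integral_id_stableLevy_Ioi hα1 hR]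
  refine conv_Ici_le _ |>.trans ?_
  rw [add_comm]
  refine add_le_add ?_ ?_
  · rw [← stableLevy_real_univ_Ioi hα1 hR]
    exact compoundPoisson_compl_zero_le
  · have h1 := measure_ge_le_exp_mul_mgf (μ := centeredPoisson (stableLevy α (Set.Ioc (R / (n + 1)) R)))
      (X := id) (c + R ^ (1 - α) / (α - 1)) hl
      (integrable_exp_mul_centeredPoisson (integrable_exp_stableLevy_Ioc hα1 hδ R l))
    refine h1.trans ?_
    rw [sub_eq_neg_add (laplaceExponent α R l), Real.exp_add, neg_mul]
    gcongr
    exact mgf_truncation_le hα1 hα2 hδ hR.le l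

theorem le_stable_tail (hα1 : 1 < α) (hα2 : α < 2) (hX : IsTotallyAsymmetricStable P α X)
    {s t k q : ℝ} {p : ℕ → ℝ} (hp : Tendsto p atTop (𝓝 q))
    (hs : ∀ n : ℕ, p n ≤ (centeredPoisson (stableLevy α (Set.Ioc (1 / (n + 1)) 1))).real (Set.Ici s))
    (hk : 0 ≤ k) (ht : k ≤ (compoundPoisson (stableLevy α (Set.Ioi 1))).real (Set.Ici t)) :
    q * k ≤ P.real {ω | X ω ≥ s + t - 1 / (α - 1)} := by
  refine le_real_of_forall_truncatedStable hα1 hα2 hX zero_lt_one (hp.mul_const k) fun n => ?_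
  have hδ : (0 : ℝ) < 1 / (n + 1) := by positivity
  have := isFiniteMeasure_stableLevy_Ioc hα1 hδ 1
  have := isFiniteMeasure_stableLevy_Ioi hα1 zero_lt_one
  rw [truncatedStable, conv_centeredPoisson_real_Ici, integral_id_stableLevy_Ioi hα1 zero_lt_one,
    Real.one_rpow, sub_add_cancel]
  refine le_trans ?_ (mul_le_conv_Ici s t)
  exact mul_le_mul (hs n) ht hk measureReal_nonneg

end TailBounds

/-! ### Lower bounds for the tail -/

section Lower

variable {α : ℝ} {Ω : Type*} [MeasurableSpace Ω] {P : Measure Ω} [IsProbabilityMeasure P]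
  {X : Ω → ℝ}

theorem truncation_real_Ici_neg_ge (hα1 : 1 < α) (hα2 : α < 2) {δ y : ℝ} (hδ : 0 < δ)
    (hy : 1 ≤ √(2 - α) * y) :
    1 - Real.exp (-2) ≤ (centeredPoisson (stableLevy α (Set.Ioc δ 1))).real (Set.Ici (-2 * y)) := by
  have := isFiniteMeasure_stableLevy_Ioc hα1 hδ 1
  have hε : 0 < 2 - α := by linarith
  -- The exponent at `-l` is at most `2`, while the Chernoff factor is at most `exp (-4)`.
  set l := 2 * √(2 - α) with hl
  have hl0 : 0 ≤ l := by positivity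
  have h1 := measure_le_le_exp_mul_mgf (μ := centeredPoisson (stableLevy α (Set.Ioc δ 1)))
    (X := id) (-2 * y) (neg_nonpos.2 hl0)
    (integrable_exp_mul_centeredPoisson (integrable_exp_stableLevy_Ioc hα1 hδ 1 (-l)))
  have h2 := mgf_truncation_le hα1 hα2 hδ zero_le_one (-l)
  have h3 := laplaceExponent_one_neg_le hα2 hl0
  have h4 : l ^ 2 / (2 * (2 - α)) = 2 := by
    rw [hl, mul_pow, Real.sq_sqrt hε.le]
    field_simp
  have h5 : (centeredPoisson (stableLevy α (Set.Ioc δ 1))).real {x | id x ≤ -2 * y}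
      ≤ Real.exp (-2) := by
    refine h1.trans ?_
    calc _ ≤ Real.exp (- -l * (-2 * y)) * Real.exp 2 := by
          gcongr
          exact h2.trans (Real.exp_le_exp.2 (h3.trans_eq h4))
      _ ≤ Real.exp (-2) := by
          rw [← Real.exp_add]
          refine Real.exp_le_exp.2 ?_
          rw [hl]
          nlinarith
  have h6 := measureReal_compl (μ := centeredPoisson (stableLevy α (Set.Ioc δ 1)))
    (measurableSet_Ici (a := -2 * y))
  rw [probReal_univ] at h6
  have h7 : (centeredPoisson (stableLevy α (Set.Ioc δ 1))).real (Set.Ici (-2 * y))ᶜ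
      ≤ (centeredPoisson (stableLevy α (Set.Ioc δ 1))).real {x | id x ≤ -2 * y} := by
    refine measureReal_mono fun x hx => ?_
    simp only [Set.mem_compl_iff, Set.mem_Ici, not_le] at hx
    exact hx.le
  linarith

theorem exp_neg_one_le_exp_neg_mass (hα1 : 1 < α) :
    Real.exp (-1) ≤ Real.exp (-(stableLevy α (Set.Ioi 1)).real Set.univ) := by
  rw [stableLevy_real_univ_Ioi hα1 zero_lt_one, Real.one_rpow, mul_one]
  refine Real.exp_le_exp.2 (neg_le_neg ?_)
  rw [div_le_one (by linarith)]
  exact hα1.le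

/-- A single jump larger than `3y` already makes the tail at least of order `y^{-α}`. -/
theorem le_stable_tail_rpow (hα1 : 1 < α) (hα2 : α < 2) (hX : IsTotallyAsymmetricStable P α X)
    {y : ℝ} (hy : 1 ≤ √(2 - α) * y) (hy1 : 1 ≤ y) :
    1 / 100 * (1 / y ^ α) ≤ P.real {ω | X ω ≥ y - 1 / (α - 1)} := by
  have := isFiniteMeasure_stableLevy_Ioi hα1 zero_lt_one
  have hy0 : 0 < y := by linarith
  have hk : Real.exp (-1) * (1 / (α * (3 * y) ^ α))
      ≤ (compoundPoisson (stableLevy α (Set.Ioi 1))).real (Set.Ici (3 * y)) := by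
    refine le_trans ?_ (le_compoundPoisson_one _)
    exact mul_le_mul (exp_neg_one_le_exp_neg_mass hα1)
      (le_stableLevy_Ioi_real_Ici hα1 zero_lt_one (by linarith)) (by positivity) (by positivity)
  have h := le_stable_tail hα1 hα2 hX (s := -2 * y) (t := 3 * y)
    (tendsto_const_nhds (x := 1 - Real.exp (-2)))
    (fun n => truncation_real_Ici_neg_ge hα1 hα2 (by positivity) hy) (by positivity) hk
  rw [show -2 * y + 3 * y = y by ring] at h
  refine le_trans ?_ h
  have h3 : (3 : ℝ) ^ α ≤ 9 := by
    calc (3 : ℝ) ^ α ≤ 3 ^ (2 : ℝ) := Real.rpow_le_rpow_of_exponent_le (by norm_num) hα2.le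
      _ = 9 := by norm_num
  have h4 : 1 / 18 * (1 / y ^ α) ≤ 1 / (α * (3 * y) ^ α) := by
    rw [Real.mul_rpow (by norm_num) hy0.le, one_div_mul_one_div]
    refine one_div_le_one_div_of_le (by positivity) ?_
    have : α * 3 ^ α ≤ 2 * 9 := by gcongr
    have : 0 < y ^ α := by positivity
    nlinarith
  have he1 : (1 / 3 : ℝ) ≤ Real.exp (-1) := by
    rw [Real.exp_neg, one_div]
    exact inv_anti₀ (Real.exp_pos 1) (by linarith [Real.exp_one_lt_d9])
  have he2 : Real.exp (-2) ≤ 1 / 4 := by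
    rw [Real.exp_neg, one_div]
    refine inv_anti₀ (by norm_num) ?_
    have := Real.quadratic_le_exp_of_nonneg (x := 2) (by norm_num)
    norm_num at this
    linarith
  calc 1 / 100 * (1 / y ^ α) ≤ 3 / 4 * (1 / 3 * (1 / 18 * (1 / y ^ α))) := by
        have : 0 < 1 / y ^ α := by positivity
        linarith
    _ ≤ (1 - Real.exp (-2)) * (Real.exp (-1) * (1 / (α * (3 * y) ^ α))) := by
        have h5 : (3 / 4 : ℝ) ≤ 1 - Real.exp (-2) := by linarith
        gcongr

theorem exp_one_bounds : (2.7 : ℝ) < Real.exp 1 ∧ Real.exp 1 < 2.72 :=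
  ⟨by linarith [Real.exp_one_gt_d9], by linarith [Real.exp_one_lt_d9]⟩

theorem laplaceExponent_one_two_mul_le (hα1 : 1 < α) (hα2 : α < 2) {l : ℝ} (hl0 : 0 ≤ l)
    (hl1 : l ≤ 1) : laplaceExponent α 1 (2 * l) ≤ 2 * l ^ 2 / (2 - α) + 2.4 := by
  have h := laplaceExponent_le hα2 zero_lt_one (l := 2 * l) (by positivity)
  have h1 := exp_sub_quadratic_mul_le (s := l) (u := 2) hl0 hl1 (by norm_num)
  have h2 := exp_sub_quadratic_nonneg (u := 2) (by norm_num)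
  -- The constant `2.4` comes from the cubic remainder at `2`, namely `exp 2 - 5`.
  have h3 : Real.exp 2 ≤ 7.4 := by
    rw [show (2 : ℝ) = 1 + 1 by norm_num, Real.exp_add]
    nlinarith [exp_one_bounds.1, exp_one_bounds.2]
  have h4 := exp_sub_quadratic_nonneg (u := l * 2) (by positivity)
  have h5 : l ^ 3 ≤ 1 := pow_le_one₀ hl0 hl1
  rw [Real.one_rpow, mul_one, div_one, one_mul, mul_comm 2 l] at h
  have h6 : (Real.exp (l * 2) - 1 - l * 2 - (l * 2) ^ 2 / 2) / (3 - α)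
      ≤ Real.exp (l * 2) - 1 - l * 2 - (l * 2) ^ 2 / 2 := div_le_self h4 (by linarith)
  have h7 : (l * 2) ^ 2 / (2 * (2 - α)) = 2 * l ^ 2 / (2 - α) := by
    have : 2 - α ≠ 0 := by linarith
    field_simp
  rw [h7, mul_comm l 2] at h
  rw [mul_comm l 2] at h6 h1
  nlinarith

/-- The small jumps alone make the tail at least of Gaussian order. -/
theorem le_stable_tail_gaussian (hα1 : 1 < α) (hα2 : α < 2) (hX : IsTotallyAsymmetricStable P α X)
    {y : ℝ} (hy0 : 0 < y) (hy : y ≤ 1 / (2 - α)) (hw : 4 ≤ (2 - α) * y ^ 2) :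
    1 / 100 * Real.exp (-(2 - α) * y ^ 2) ≤ P.real {ω | X ω ≥ 1 / 4 * y - 1 / (α - 1)} := by
  have hε : 0 < 2 - α := by linarith
  set w := (2 - α) * y ^ 2 with hwdef
  -- The optimal tilt for a Gaussian of variance `1 / (2 - α)` at level `y`; the upper bound on `y`
  -- makes it at most `1`, keeping the cubic remainder bounded.
  set l := y * (2 - α) with hl
  have hl0 : 0 ≤ l := by positivity
  have hl1 : l ≤ 1 := (le_div_iff₀ hε).1 hy
  have := isFiniteMeasure_stableLevy_Ioi hα1 zero_lt_one
  have hlw : l ^ 2 / (2 - α) = w := by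
    rw [hl, hwdef]
    field_simp
  have hlow : Real.exp (w / 2) ≤ Real.exp (laplaceExponent α 1 l) := by
    refine Real.exp_le_exp.2 (le_trans (le_of_eq ?_) (le_laplaceExponent_one hα2 hl0))
    rw [← hlw]
    field_simp
  have hup : Real.exp (laplaceExponent α 1 (2 * l)) ≤ Real.exp (2 * w + 2.4) := by
    refine Real.exp_le_exp.2 ((laplaceExponent_one_two_mul_le hα1 hα2 hl0 hl1).trans_eq ?_)
    rw [← hlw]
    ring
  have hz : Real.exp (l * (1 / 4 * y)) = Real.exp (w / 4) := by
    rw [hl, hwdef]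
    ring_nf
  set D := Real.exp (w / 2) - Real.exp (w / 4) with hD
  set M := Real.exp (2 * w + 2.4) with hM
  have hM0 : 0 < M := Real.exp_pos _
  have hD0 : 0 < D := sub_pos.2 (Real.exp_lt_exp.2 (by linarith))
  -- The maximiser of `4 τ (D - τ M)`, with value `D ^ 2 / M`. It depends only on limiting
  -- quantities, not on `n`.
  set τ := D / (2 * M) with hτ
  have hτ0 : 0 < τ := by positivity
  have hk : Real.exp (-1) ≤ (compoundPoisson (stableLevy α (Set.Ioi 1))).real (Set.Ici 0) :=
    (exp_neg_one_le_exp_neg_mass hα1).trans (le_compoundPoisson_zero _ Set.self_mem_Ici)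
  have hp : Tendsto (fun n : ℕ =>
      4 * τ * (mgf id (centeredPoisson (stableLevy α (Set.Ioc (1 / (n + 1)) 1))) l
        - Real.exp (l * (1 / 4 * y))
        - τ * mgf id (centeredPoisson (stableLevy α (Set.Ioc (1 / (n + 1)) 1))) (2 * l))) atTop
      (𝓝 (4 * τ * (Real.exp (laplaceExponent α 1 l) - Real.exp (l * (1 / 4 * y))
        - τ * Real.exp (laplaceExponent α 1 (2 * l))))) :=
    (((tendsto_mgf_truncation hα1 hα2 zero_lt_one l).sub_const _).sub
      ((tendsto_mgf_truncation hα1 hα2 zero_lt_one (2 * l)).const_mul τ)).const_mul (4 * τ)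
  have h := le_stable_tail hα1 hα2 hX (s := 1 / 4 * y) (t := 0) hp
    (fun n => by
      have hδ : (0 : ℝ) < 1 / (n + 1) := by positivity
      have := isFiniteMeasure_stableLevy_Ioc hα1 hδ 1
      exact le_real_Ici_of_mgf hl0 hτ0
        (integrable_exp_mul_centeredPoisson (integrable_exp_stableLevy_Ioc hα1 hδ 1 l))
        (integrable_exp_mul_centeredPoisson (integrable_exp_stableLevy_Ioc hα1 hδ 1 (2 * l))))
    (Real.exp_pos _).le hk
  rw [add_zero] at h
  refine le_trans ?_ h
  have hD2 : D ^ 2 / M ≤ 4 * τ * (Real.exp (laplaceExponent α 1 l) - Real.exp (l * (1 / 4 * y))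
        - τ * Real.exp (laplaceExponent α 1 (2 * l))) := by
    calc D ^ 2 / M = 4 * τ * (D - τ * M) := by rw [hτ]; field_simp; ring
      _ ≤ _ := by
        rw [hz, hD]
        gcongr
  have he1 : (1 / 2.72 : ℝ) ≤ Real.exp (-1) := by
    rw [Real.exp_neg, one_div]
    exact inv_anti₀ (Real.exp_pos 1) exp_one_bounds.2.le
  have he2 : Real.exp (-1) ≤ 1 / 2.7 := by
    rw [Real.exp_neg, one_div]
    exact inv_anti₀ (by norm_num) exp_one_bounds.1.le
  have hDw : D = Real.exp (w / 2) * (1 - Real.exp (-(w / 4))) := by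
    rw [mul_sub, ← Real.exp_add, hD]
    ring_nf
  have hD3 : D ^ 2 / M = (1 - Real.exp (-(w / 4))) ^ 2 * Real.exp (-w) * Real.exp (-2.4) := by
    rw [hDw, mul_pow, ← Real.exp_nat_mul, hM, div_eq_mul_inv, ← Real.exp_neg,
      mul_right_comm, mul_comm, ← Real.exp_add, mul_assoc, ← Real.exp_add]
    push_cast
    ring_nf
  have h24 : (1 / 12 : ℝ) ≤ Real.exp (-2.4) := by
    rw [Real.exp_neg, one_div]
    refine inv_anti₀ (Real.exp_pos _) ?_
    have h5 : Real.exp 2.4 ^ 5 ≤ 12 ^ 5 := by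
      rw [← Real.exp_nat_mul, show ((5 : ℕ) : ℝ) * 2.4 = (12 : ℕ) * 1 by norm_num, Real.exp_nat_mul]
      calc Real.exp 1 ^ 12 ≤ 2.72 ^ 12 := by gcongr; exact exp_one_bounds.2.le
        _ ≤ 12 ^ 5 := by norm_num
    exact le_of_pow_le_pow_left₀ (by norm_num) (by norm_num) h5
  have hq : Real.exp (-(w / 4)) ≤ 1 / 2.7 :=
    (Real.exp_le_exp.2 (by linarith)).trans he2
  have hneg : -(2 - α) * y ^ 2 = -w := by rw [hwdef]; ring
  rw [hneg]
  calc 1 / 100 * Real.exp (-w)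
      ≤ (1 - 1 / 2.7) ^ 2 * Real.exp (-w) * (1 / 12) * (1 / 2.72) := by
        have := Real.exp_pos (-w)
        norm_num
        linarith
    _ ≤ D ^ 2 / M * Real.exp (-1) := by
        rw [hD3]
        gcongr
    _ ≤ _ := by gcongr

end Lower

/-! ### Upper bounds for the tail -/

section LogBounds

/-- Reduces a rational bound on a logarithm to a comparison of rational powers, using a decimal
bound for `exp 1`. -/
theorem log_le_of_pow_le {Y : ℝ} (hY : 0 < Y) (p q : ℕ) (hq : q ≠ 0)
    (h : Y ^ q ≤ 2.7182818283 ^ p) : Real.log Y ≤ p / q := by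
  have h1 : Y ^ q ≤ Real.exp p := by
    rw [← mul_one (p : ℝ), Real.exp_nat_mul]
    exact h.trans (by gcongr; exact Real.exp_one_gt_d9.le)
  have h2 := Real.log_le_log (by positivity) h1
  rw [Real.log_exp, Real.log_pow] at h2
  rw [le_div_iff₀ (by positivity)]
  linarith

theorem le_log_of_pow_le {Y : ℝ} (p q : ℕ) (hq : q ≠ 0)
    (h : (2.7182818286 : ℝ) ^ p ≤ Y ^ q) : p / q ≤ Real.log Y := by
  have h1 : Real.exp p ≤ Y ^ q := by
    rw [← mul_one (p : ℝ), Real.exp_nat_mul]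
    exact le_trans (by gcongr; exact Real.exp_one_lt_d9.le) h
  have h2 := Real.log_le_log (Real.exp_pos _) h1
  rw [Real.log_exp, Real.log_pow] at h2
  rw [div_le_iff₀ (by positivity)]
  linarith

theorem exp_le_of_pow_le {Y : ℝ} (hY : 0 < Y) (p q : ℕ) (hq : q ≠ 0)
    (h : (2.7182818286 : ℝ) ^ p ≤ Y ^ q) : Real.exp (p / q) ≤ Y :=
  (Real.le_log_iff_exp_le hY).1 (le_log_of_pow_le p q hq h)

theorem log_div_self_le_of_pos {x : ℝ} (hx : 0 < x) : Real.log x / x ≤ 0.37 := by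
  have h := Real.log_le_sub_one_of_pos (x := x / Real.exp 1) (by positivity)
  rw [Real.log_div hx.ne' (Real.exp_pos 1).ne', Real.log_exp] at h
  rw [div_le_iff₀ hx]
  have h2 : x / Real.exp 1 ≤ 0.37 * x := by
    rw [div_le_iff₀ (Real.exp_pos 1)]
    nlinarith [Real.exp_one_gt_d9]
  linarith

theorem log_div_self_le {Y y c : ℝ} (hY : 3 ≤ Y) (hy : Y ≤ y) (hc : Real.log Y ≤ c * Y) :
    Real.log y / y ≤ c := by
  have he : Real.exp 1 ≤ Y := by linarith [Real.exp_one_lt_d9]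
  refine (Real.log_div_self_antitoneOn he (he.trans hy) hy).trans ?_
  exact (div_le_iff₀ (by linarith)).2 hc

/-- By concavity, `x ≤ c log x` holds on an interval as soon as it holds at its endpoints. -/
theorem le_mul_log_of_mem_Icc {a b c x : ℝ} (ha : 0 < a) (hc : 0 ≤ c) (hax : a ≤ x) (hxb : x ≤ b)
    (hca : a ≤ c * Real.log a) (hcb : b ≤ c * Real.log b) : x ≤ c * Real.log x := by
  rcases hax.eq_or_lt with rfl | hlt
  · exact hca
  have hab : 0 < b - a := by linarith
  have h := strictConcaveOn_log_Ioi.concaveOn.2 (Set.mem_Ioi.2 ha)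
    (Set.mem_Ioi.2 (show 0 < b by linarith)) (div_nonneg (sub_nonneg.2 hxb) hab.le)
    (div_nonneg (sub_nonneg.2 hax) hab.le) (by field_simp; ring)
  simp only [smul_eq_mul] at h
  have hx : (b - x) / (b - a) * a + (x - a) / (b - a) * b = x := by field_simp; ring
  rw [hx] at h
  have h1 : 0 ≤ (b - x) / (b - a) := div_nonneg (by linarith) hab.le
  have h2 : 0 ≤ (x - a) / (b - a) := div_nonneg (by linarith) hab.le
  calc x = (b - x) / (b - a) * a + (x - a) / (b - a) * b := hx.symm
    _ ≤ (b - x) / (b - a) * (c * Real.log a) + (x - a) / (b - a) * (c * Real.log b) := by gcongr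
    _ = c * ((b - x) / (b - a) * Real.log a + (x - a) / (b - a) * Real.log b) := by ring
    _ ≤ c * Real.log x := by gcongr

theorem log_four_log_five_bounds : 11 / 8 ≤ Real.log 4 ∧ Real.log 4 ≤ 7 / 5 ∧
    8 / 5 ≤ Real.log 5 ∧ Real.log 5 ≤ 29 / 18 := by
  refine ⟨?_, ?_, ?_, ?_⟩
  · exact_mod_cast le_log_of_pow_le (Y := 4) 11 8 (by norm_num) (by norm_num)
  · exact_mod_cast log_le_of_pow_le (Y := 4) (by norm_num) 7 5 (by norm_num) (by norm_num)
  · exact_mod_cast le_log_of_pow_le (Y := 5) 8 5 (by norm_num) (by norm_num)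
  · exact_mod_cast log_le_of_pow_le (Y := 5) (by norm_num) 29 18 (by norm_num) (by norm_num)

theorem log_eight_log_twelve_bounds : 27 / 13 ≤ Real.log 8 ∧ Real.log 8 ≤ 52 / 25 ∧
    77 / 31 ≤ Real.log 12 ∧ Real.log 12 ≤ 87 / 35 := by
  refine ⟨?_, ?_, ?_, ?_⟩
  · exact_mod_cast le_log_of_pow_le (Y := 8) 27 13 (by norm_num) (by norm_num)
  · exact_mod_cast log_le_of_pow_le (Y := 8) (by norm_num) 52 25 (by norm_num) (by norm_num)
  · exact_mod_cast le_log_of_pow_le (Y := 12) 77 31 (by norm_num) (by norm_num)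
  · exact_mod_cast log_le_of_pow_le (Y := 12) (by norm_num) 87 35 (by norm_num) (by norm_num)

theorem exp_rational_bounds : Real.exp (7 / 20) ≤ 1.42 ∧ Real.exp (29 / 90) ≤ 1.381 ∧
    Real.exp (13 / 50) ≤ 1.298 ∧ Real.exp (29 / 140) ≤ 1.231 := by
  refine ⟨?_, ?_, ?_, ?_⟩
  · exact_mod_cast exp_le_of_pow_le (Y := 1.42) (by norm_num) 7 20 (by norm_num) (by norm_num)
  · exact_mod_cast exp_le_of_pow_le (Y := 1.381) (by norm_num) 29 90 (by norm_num) (by norm_num)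
  · exact_mod_cast exp_le_of_pow_le (Y := 1.298) (by norm_num) 13 50 (by norm_num) (by norm_num)
  · exact_mod_cast exp_le_of_pow_le (Y := 1.231) (by norm_num) 29 140 (by norm_num) (by norm_num)

theorem exp_neg_eight_fifths_le : Real.exp (-1.6) ≤ 0.203 := by
  have h := log_le_of_pow_le (Y := 4.93) (by norm_num) 8 5 (by norm_num) (by norm_num)
  rw [Real.log_le_iff_le_exp (by norm_num)] at h
  rw [Real.exp_neg]
  refine (inv_anti₀ (by norm_num) (h.trans_eq (by norm_num))).trans (by norm_num)

end LogBounds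

/-! ### Chernoff bound with cutoff `y` -/

section Chernoff

variable {α : ℝ} {Ω : Type*} [MeasurableSpace Ω] {P : Measure Ω} [IsProbabilityMeasure P]
  {X : Ω → ℝ}

/-- Bounds the mean of the jumps in `(1, y]`, uniformly as `α` approaches `1`. -/
theorem one_sub_rpow_div_le_log (hα1 : 1 < α) {y : ℝ} (hy : 0 < y) :
    1 / (α - 1) - y ^ (1 - α) / (α - 1) ≤ Real.log y := by
  rw [← sub_div, div_le_iff₀ (by linarith), Real.rpow_def_of_pos hy]
  have := Real.add_one_le_exp (Real.log y * (1 - α))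
  linarith

theorem stable_tail_two_mul_le (hα1 : 1 < α) (hα2 : α < 2)
    (hX : IsTotallyAsymmetricStable P α X) {y u : ℝ} (hy : 0 < y) (hu : 0 ≤ u) :
    P.real {ω | X ω ≥ 2 * y - 1 / (α - 1)} ≤ 1 / (α * y ^ α)
      + Real.exp (1 / y ^ α * (u ^ 2 / (2 * (2 - α))) + 1 / y ^ α * Real.exp u - 2 * u
        + u * (Real.log y / y)) := by
  have h := stable_tail_le hα1 hα2 hX hy (l := u / y) (by positivity) (2 * y - 1 / (α - 1))
  refine h.trans ?_
  gcongr
  have h1 := laplaceExponent_le hα2 hy (l := u / y) (by positivity)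
  rw [div_mul_cancel₀ _ hy.ne'] at h1
  have h2 : (Real.exp u - 1 - u - u ^ 2 / 2) / (3 - α) ≤ Real.exp u :=
    (div_le_self (exp_sub_quadratic_nonneg hu) (by linarith)).trans (by nlinarith [sq_nonneg u])
  have h3 : laplaceExponent α y (u / y) ≤ 1 / y ^ α * (u ^ 2 / (2 * (2 - α)) + Real.exp u) :=
    h1.trans (by gcongr)
  have h4 := mul_le_mul_of_nonneg_left (one_sub_rpow_div_le_log hα1 hy)
    (show 0 ≤ u / y by positivity)
  have h5 : u / y * (2 * y) = 2 * u := by field_simp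
  have h6 : u / y * Real.log y = u * (Real.log y / y) := by ring
  linarith

/-- The tail beyond the Gaussian regime. -/
theorem stable_tail_le_rpow (hα1 : 1 < α) (hα2 : α < 2) (hX : IsTotallyAsymmetricStable P α X)
    {y : ℝ} (hy : 1 / (2 - α) ≤ y) :
    P.real {ω | X ω ≥ 2 * y - 1 / (α - 1)} ≤ 8 / y ^ α := by
  have hε : 0 < 2 - α := by linarith
  have hy1 : 1 ≤ y := le_trans (by rw [le_div_iff₀ hε]; linarith) hy
  have hy0 : 0 < y := by linarith
  have hlog : 0 ≤ Real.log y := Real.log_nonneg hy1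
  -- With `exp u = y ^ α` the remainder contributes exactly `1`. The quadratic and drift terms cost
  -- at most `0.6 u + 0.37 u ≤ u`, leaving the exponent `1 - u`.
  set u := α * Real.log y with hu
  have hu0 : 0 ≤ u := by positivity
  refine (stable_tail_two_mul_le hα1 hα2 hX hy0 hu0).trans ?_
  have ha : 0 < y ^ α := by positivity
  have heu : Real.exp u = y ^ α := by rw [Real.rpow_def_of_pos hy0, hu, mul_comm]
  have hL := log_div_self_le_of_pos hy0
  have hV : 1 / y ^ α * (u / (2 * (2 - α))) ≤ 0.6 := by
    rcases le_total α (3 / 2) with h | h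
    · have h1 := log_div_self_le_of_pos ha
      rw [Real.log_rpow hy0, ← hu] at h1
      calc 1 / y ^ α * (u / (2 * (2 - α))) = u / y ^ α / (2 * (2 - α)) := by ring
        _ ≤ u / y ^ α := div_le_self (by positivity) (by linarith)
        _ ≤ 0.6 := by linarith
    · have hz : 0 < y ^ (α - 1) := by positivity
      have h1 := log_div_self_le_of_pos hz
      rw [Real.log_rpow hy0] at h1
      have hz2 : y ^ α = y ^ (α - 1) * y := by
        rw [← Real.rpow_add_one hy0.ne']
        ring_nf
      have h2 : 1 / (2 - α) / y ≤ 1 := by rwa [div_le_one hy0]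
      have h3 : 0 ≤ (α - 1) * Real.log y / y ^ (α - 1) :=
        div_nonneg (mul_nonneg (by linarith) hlog) hz.le
      have h4 : α / (α - 1) ≤ 3 := by
        rw [div_le_iff₀ (by linarith)]
        linarith
      have h5 : α - 1 ≠ 0 := by linarith
      calc 1 / y ^ α * (u / (2 * (2 - α)))
          = α / (α - 1) * ((α - 1) * Real.log y / y ^ (α - 1)) / 2 * (1 / (2 - α) / y) := by
            rw [hz2, hu]
            field_simp
        _ ≤ 3 * 0.37 / 2 * 1 := by gcongr
        _ ≤ 0.6 := by norm_num
  have hE : 1 / y ^ α * (u ^ 2 / (2 * (2 - α))) + 1 / y ^ α * Real.exp u - 2 * u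
        + u * (Real.log y / y) ≤ 1 - u := by
    rw [heu, one_div_mul_cancel ha.ne']
    have h1 : 1 / y ^ α * (u ^ 2 / (2 * (2 - α))) = u * (1 / y ^ α * (u / (2 * (2 - α)))) := by ring
    rw [h1]
    nlinarith
  have h1 : Real.exp (1 - u) = Real.exp 1 / y ^ α := by rw [Real.exp_sub, heu]
  have h2 : 1 / (α * y ^ α) ≤ 1 / y ^ α := by
    refine one_div_le_one_div_of_le ha ?_
    nlinarith
  calc _ ≤ 1 / y ^ α + Real.exp 1 / y ^ α := by
        refine add_le_add h2 ?_
        rw [← h1]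
        exact Real.exp_le_exp.2 hE
    _ = (1 + Real.exp 1) / y ^ α := by ring
    _ ≤ 8 / y ^ α := by
        gcongr
        linarith [Real.exp_one_lt_d9]

end Chernoff

/-! ### Choice of the Chernoff parameter in the Gaussian regime -/

section GaussianRegime

theorem one_div_rpow_mul_le {α y : ℝ} (hα2 : α < 2) (hy : 0 < y) (hy1 : 1 ≤ y)
    (hyε : y ≤ 1 / (2 - α)) (u : ℝ) :
    1 / y ^ α * (u ^ 2 / (2 * (2 - α)))
      ≤ Real.exp (Real.log y / y) * u ^ 2 / (2 * ((2 - α) * y ^ 2)) := by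
  have hε : 0 < 2 - α := by linarith
  have h1 : (2 - α) ≤ 1 / y := by
    rw [le_div_iff₀ hy, mul_comm]
    exact (le_div_iff₀ hε).1 hyε
  have h2 : y ^ (2 - α) ≤ Real.exp (Real.log y / y) := by
    rw [Real.rpow_def_of_pos hy]
    refine Real.exp_le_exp.2 ?_
    calc Real.log y * (2 - α) ≤ Real.log y * (1 / y) := by
          gcongr
          exact Real.log_nonneg hy1
      _ = _ := by ring
  have h3 : y ^ (2 - α) = 1 / y ^ α * y ^ 2 := by
    have := one_div_rpow_mul_pow hy α 2
    push_cast at this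
    exact this.symm
  calc 1 / y ^ α * (u ^ 2 / (2 * (2 - α)))
      = y ^ (2 - α) * u ^ 2 / (2 * ((2 - α) * y ^ 2)) := by
        rw [h3]
        field_simp
    _ ≤ _ := by gcongr

/-- An exponent below `-w/2 + 1/4` is absorbed by the Gaussian term. -/
theorem exp_le_add_gaussian {a b w E : ℝ} (hb : 0 ≤ b) (ha : 0 ≤ a)
    (h : E ≤ -w / 2 + 1 / 4) :
    Real.exp E ≤ b * a + Real.exp (1 / 4) * Real.exp (-(w / 2)) := by
  have h1 : Real.exp E ≤ Real.exp (1 / 4) * Real.exp (-(w / 2)) := by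
    rw [← Real.exp_add]
    exact Real.exp_le_exp.2 (by linarith)
  have := mul_nonneg hb ha
  linarith

/-- With `ρ = w / u`, the convex function `C₀ / (2 ρ) + ρ / 2` takes equal values at `ρ = r` and `ρ
= C₀ / r`, so between them it is at most that value. -/
theorem exponent_le_of_ratio {u w L C L₀ C₀ r : ℝ} (hu : 0 < u) (hw : 0 < w) (hL : L ≤ L₀)
    (hC : C ≤ C₀) (hr : 0 < r) (hwr : w ≤ r * u) (hwC : C₀ * u ≤ r * w) :
    C * u ^ 2 / (2 * w) - 2 * u + u * L + w / 2 ≤ (C₀ / (2 * r) + r / 2 - 2 + L₀) * u := by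
  have h1 : C * u ^ 2 / (2 * w) ≤ C₀ * u ^ 2 / (2 * w) := by gcongr
  have h2 : u * L ≤ u * L₀ := by gcongr
  have h3 : C₀ * u ^ 2 / (2 * w) + w / 2 ≤ (C₀ / (2 * r) + r / 2) * u := by
    have h4 : (C₀ / (2 * r) + r / 2) * u - (C₀ * u ^ 2 / (2 * w) + w / 2)
        = (r * u - w) * (r * w - C₀ * u) / (2 * r * w) := by
      field_simp
      ring
    have h5 : 0 ≤ (r * u - w) * (r * w - C₀ * u) / (2 * r * w) :=
      div_nonneg (mul_nonneg (by linarith) (by linarith)) (by positivity)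
    linarith
  linarith

/-- The coefficient `2 / exp 1 - 1 / α` is what the target leaves after paying for a jump above `y`.
The cases follow the ratio of `w` to `α log y`. Since `w ≤ y`, a larger ratio forces a larger `y`,
which improves the bounds on `α` and on `log y / y`. -/
theorem exists_chernoff_parameter {α y : ℝ} (hα2 : α < 2) (hyε : y ≤ 1 / (2 - α))
    (hy0 : 0 < y) (hw4 : 4 ≤ (2 - α) * y ^ 2) :
    ∃ u, 0 ≤ u ∧ Real.exp (Real.exp (Real.log y / y) * u ^ 2 / (2 * ((2 - α) * y ^ 2))
        + 1 / y ^ α * Real.exp u - 2 * u + u * (Real.log y / y))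
      ≤ (2 / Real.exp 1 - 1 / α) * (1 / y ^ α)
        + Real.exp (1 / 4) * Real.exp (-((2 - α) * y ^ 2 / 2)) := by
  have hε : 0 < 2 - α := by linarith
  set w := (2 - α) * y ^ 2 with hw
  have hεy : (2 - α) * y ≤ 1 := by
    rw [mul_comm]
    exact (le_div_iff₀ hε).1 hyε
  have hwy : w ≤ y := by
    rw [hw]
    nlinarith
  have hy4 : 4 ≤ y := hw4.trans hwy
  have hw0 : 0 < w := by linarith
  have hα_ge : ∀ Y, 0 < Y → Y ≤ y → 2 - 1 / Y ≤ α := by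
    intro Y hY hYy
    have : 2 - α ≤ 1 / Y := by
      rw [le_div_iff₀ hY]
      nlinarith
    linarith
  have hα : 7 / 4 ≤ α := by
    have := hα_ge 4 (by norm_num) hy4
    linarith
  have ha : 0 < y ^ α := by positivity
  obtain ⟨hlog4, hlog4', hlog5, hlog5'⟩ := log_four_log_five_bounds
  obtain ⟨hlog8, hlog8', hlog12, hlog12'⟩ := log_eight_log_twelve_bounds
  obtain ⟨hexp4, hexp5, hexp8, hexp12⟩ := exp_rational_bounds
  set L := Real.log y / y with hL
  set u := α * Real.log y with hu
  have hlogy : 0 < Real.log y := Real.log_pos (by linarith)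
  have hu0 : 0 < u := by positivity
  have heu : Real.exp u = y ^ α := by rw [Real.rpow_def_of_pos hy0, hu, mul_comm]
  have hleft : 0 ≤ 2 / Real.exp 1 - 1 / α := by
    have h1 : 1 / α ≤ 4 / 7 := by
      rw [div_le_div_iff₀ (by linarith) (by norm_num)]
      linarith
    have h2 : (0.7 : ℝ) ≤ 2 / Real.exp 1 := by
      rw [le_div_iff₀ (Real.exp_pos 1)]
      linarith [Real.exp_one_lt_d9]
    linarith
  rcases le_or_gt w (20 / 11 * u) with hA | hA
  -- Here `exp u ≤ y ^ α` still holds for this smaller parameter, and `w ≥ 4` absorbs the resulting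
  -- constant `1`.
  · refine ⟨11 / 20 * w, by positivity, exp_le_add_gaussian hleft (by positivity) ?_⟩
    have hL4 : L ≤ 7 / 20 := log_div_self_le (by norm_num) hy4 (by linarith)
    have hC4 : Real.exp L ≤ 1.42 := (Real.exp_le_exp.2 hL4).trans hexp4
    have h1 : 1 / y ^ α * Real.exp (11 / 20 * w) ≤ 1 := by
      rw [one_div, inv_mul_le_one₀ ha, ← heu]
      exact Real.exp_le_exp.2 (by linarith)
    have h2 : Real.exp L * (11 / 20 * w) ^ 2 / (2 * w) = Real.exp L * w * (121 / 800) := by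
      field_simp
      ring
    rw [h2]
    have h3 := mul_le_mul_of_nonneg_right hC4 hw0.le
    have h4 := mul_le_mul_of_nonneg_left hL4 hw0.le
    linarith
  refine ⟨u, hu0.le, ?_⟩
  rw [heu, one_div_mul_cancel ha.ne']
  have hlow : ∀ Y, 4 ≤ Y → Y ≤ y → (2 - 1 / Y) * Real.log Y ≤ u := by
    intro Y hY hYy
    rw [hu]
    exact mul_le_mul (hα_ge Y (by linarith) hYy) (Real.log_le_log (by linarith) hYy)
      (Real.log_nonneg (by linarith)) (by linarith)
  -- For `y` in `[4, 5]`, concavity gives `y ≤ (20 / 11) α log y < w`, contradicting `w ≤ y`. The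
  -- breakpoints `8` and `12` arise in the same way.
  have hy5 : 5 ≤ y := by
    by_contra! hlt
    have := le_mul_log_of_mem_Icc (c := 20 / 11 * (7 / 4)) (by norm_num) (by norm_num) hy4 hlt.le
      (by linarith) (by linarith)
    have h := mul_le_mul_of_nonneg_right hα hlogy.le
    linarith
  have hu5 : 1.8 * (8 / 5) ≤ u := by
    have := hlow 5 (by norm_num) hy5
    linarith
  rcases le_or_gt w (2.15 * u) with hB | hB
  · refine exp_le_add_gaussian hleft (by positivity) ?_
    have hL5 : L ≤ 29 / 90 := log_div_self_le (by norm_num) hy5 (by linarith)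
    have := exponent_le_of_ratio (r := 2.15) hu0 hw0 hL5
      ((Real.exp_le_exp.2 hL5).trans hexp5) (by norm_num) hB (by linarith)
    norm_num at this
    linarith
  have hα5 := hα_ge 5 (by norm_num) hy5
  have hy8 : 8 ≤ y := by
    by_contra! hlt
    have := le_mul_log_of_mem_Icc (c := 2.15 * (9 / 5)) (by norm_num) (by norm_num) hy5 hlt.le
      (by linarith) (by linarith)
    have h := mul_le_mul_of_nonneg_right hα5 hlogy.le
    linarith
  have hu8 : 15 / 8 * (27 / 13) ≤ u := by
    have := hlow 8 (by norm_num) hy8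
    linarith
  rcases le_or_gt w (2.58 * u) with hC | hC
  · refine exp_le_add_gaussian hleft (by positivity) ?_
    have hL8 : L ≤ 13 / 50 := log_div_self_le (by norm_num) hy8 (by linarith)
    have := exponent_le_of_ratio (r := 2.58) hu0 hw0 hL8
      ((Real.exp_le_exp.2 hL8).trans hexp8) (by norm_num) hC (by linarith)
    norm_num at this
    linarith
  have hα8 := hα_ge 8 (by norm_num) hy8
  have hy12 : 12 ≤ y := by
    by_contra! hlt
    have := le_mul_log_of_mem_Icc (c := 2.58 * (15 / 8)) (by norm_num) (by norm_num) hy8 hlt.le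
      (by linarith) (by linarith)
    have h := mul_le_mul_of_nonneg_right hα8 hlogy.le
    linarith
  have hu12 : 23 / 12 * (77 / 31) ≤ u := by
    have := hlow 12 (by norm_num) hy12
    linarith
  have hα12 := hα_ge 12 (by norm_num) hy12
  have hL12 : L ≤ 29 / 140 := log_div_self_le (by norm_num) hy12 (by linarith)
  have hC12 : Real.exp L ≤ 1.231 := (Real.exp_le_exp.2 hL12).trans hexp12
  have hquad : Real.exp L * u ^ 2 / (2 * w) ≤ 0.2386 * u := by
    rw [div_le_iff₀ (by positivity)]
    have h1 : Real.exp L * u ^ 2 ≤ 1.231 * u ^ 2 := by gcongr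
    have h2 := mul_le_mul_of_nonneg_left hC.le hu0.le
    linarith [sq_nonneg u]
  -- For the largest ratios the Gaussian term is not used: the exponent falls below `-u` by `1.6`,
  -- and `exp (-1.6)` fits in the spare coefficient of `1 / y ^ α`.
  have hE : Real.exp L * u ^ 2 / (2 * w) + 1 - 2 * u + u * L ≤ -1.6 - u := by
    have : u * L ≤ u * (29 / 140) := by gcongr
    linarith
  have hleft12 : 0.203 ≤ 2 / Real.exp 1 - 1 / α := by
    have h1 : 1 / α ≤ 12 / 23 := by
      rw [div_le_div_iff₀ (by linarith) (by norm_num)]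
      linarith
    have h2 : (0.735 : ℝ) ≤ 2 / Real.exp 1 := by
      rw [le_div_iff₀ (Real.exp_pos 1)]
      linarith [Real.exp_one_lt_d9]
    linarith
  calc _ ≤ Real.exp (-1.6 - u) := Real.exp_le_exp.2 hE
    _ = Real.exp (-1.6) * (1 / y ^ α) := by rw [Real.exp_sub, heu]; ring
    _ ≤ (2 / Real.exp 1 - 1 / α) * (1 / y ^ α) := by
        gcongr
        exact exp_neg_eight_fifths_le.trans hleft12
    _ ≤ _ := by
        have : 0 < Real.exp (1 / 4) * Real.exp (-(w / 2)) := by positivity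
        linarith

end GaussianRegime

theorem theorem12 {Ω : Type*} [MeasurableSpace Ω] (P : Measure Ω) [IsProbabilityMeasure P]
    (α : ℝ) (hα1 : 1 < α) (hα2 : α < 2) (X : Ω → ℝ)
    (hX : IsTotallyAsymmetricStable P α X) :
    (∀ y : ℝ, 2 / √(2 - α) ≤ y → y ≤ 1 / (2 - α) →
      P.real {ω | X ω ≥ 2 * y - 1 / (α - 1)}
          ≤ 2 / Real.exp 1 * (1 / y ^ α)
            + Real.exp (1 / 4) * Real.exp (-(1 / 2) * (2 - α) * y ^ 2) ∧
      P.real {ω | X ω ≥ 1 / 4 * y - 1 / (α - 1)}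
          ≥ 1 / (400 * √(Real.exp 1))
            * (Real.exp (-1) * (1 / y ^ α) + Real.exp (-(2 - α) * y ^ 2))) ∧
    (∀ y : ℝ, 1 / (2 - α) ≤ y →
      P.real {ω | X ω ≥ 2 * y - 1 / (α - 1)} ≤ 8 / y ^ α ∧
      P.real {ω | X ω ≥ y - 1 / (α - 1)} ≥ (10 : ℝ) ^ (-3 : ℤ) * (1 / y ^ α)) := by
  have hε : 0 < 2 - α := by linarith
  have hsq : 0 < √(2 - α) := Real.sqrt_pos.2 hε
  have hsq2 : √(2 - α) * √(2 - α) = 2 - α := Real.mul_self_sqrt hε.le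
  refine ⟨fun y hy1 hy2 => ?_, fun y hy => ⟨stable_tail_le_rpow hα1 hα2 hX hy, ?_⟩⟩
  · have hy0 : 0 < y := lt_of_lt_of_le (by positivity) hy1
    have hsy : 2 ≤ √(2 - α) * y := by
      rw [mul_comm]
      exact (div_le_iff₀ hsq).1 hy1
    have hw : 4 ≤ (2 - α) * y ^ 2 := by
      rw [← hsq2]
      nlinarith
    have hyy : (2 - α) * y ≤ 1 := by
      rw [mul_comm]
      exact (le_div_iff₀ hε).1 hy2
    have hy4 : 4 ≤ y := by nlinarith
    have ha : 0 < 1 / y ^ α := by positivity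
    constructor
    · obtain ⟨u, hu0, hu⟩ := exists_chernoff_parameter hα2 hy2 hy0 hw
      have h1 := stable_tail_two_mul_le hα1 hα2 hX hy0 hu0
      have h2 := one_div_rpow_mul_le hα2 hy0 (by linarith) hy2 u
      have h3 : 1 / (α * y ^ α) = 1 / α * (1 / y ^ α) := (one_div_mul_one_div _ _).symm
      have h4 : -(1 / 2) * (2 - α) * y ^ 2 = -((2 - α) * y ^ 2 / 2) := by ring
      rw [h4]
      have h5 := (Real.exp_le_exp.2 (by linarith)).trans hu (a :=
        Real.exp (1 / y ^ α * (u ^ 2 / (2 * (2 - α))) + 1 / y ^ α * Real.exp u - 2 * u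
          + u * (Real.log y / y)))
      linarith
    · have h1 := le_stable_tail_rpow hα1 hα2 hX (y := y) (by linarith) (by linarith)
      have h2 := le_stable_tail_gaussian hα1 hα2 hX hy0 hy2 hw
      have h3 : P.real {ω | X ω ≥ y - 1 / (α - 1)} ≤ P.real {ω | X ω ≥ 1 / 4 * y - 1 / (α - 1)} := by
        refine measureReal_mono fun ω hω => ?_
        simp only [Set.mem_ofPred_eq] at hω ⊢
        linarith
      have h4 : 1 / (400 * √(Real.exp 1)) ≤ 1 / 400 := by
        refine one_div_le_one_div_of_le (by norm_num) ?_
        have : 1 ≤ √(Real.exp 1) := Real.one_le_sqrt.2 (Real.one_le_exp zero_le_one)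
        linarith
      have h5 : Real.exp (-1) ≤ 1 := Real.exp_le_one_iff.2 (by norm_num)
      have h6 := Real.exp_pos (-(2 - α) * y ^ 2)
      -- The tail dominates `1 / 100` of each term separately, hence their average, so `1 / 400` of
      -- the sum leaves room.
      calc 1 / (400 * √(Real.exp 1)) * (Real.exp (-1) * (1 / y ^ α) + Real.exp (-(2 - α) * y ^ 2))
          ≤ 1 / 400 * (1 * (1 / y ^ α) + Real.exp (-(2 - α) * y ^ 2)) := by gcongr
        _ ≤ _ := by linarith
  · have hy1 : 1 ≤ y := le_trans (by rw [le_div_iff₀ hε]; linarith) hy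
    have hyy : 1 ≤ (2 - α) * y := by
      rw [mul_comm]
      exact (div_le_iff₀ hε).1 hy
    have hs1 : √(2 - α) ≤ 1 := Real.sqrt_le_one.2 (by linarith)
    have h1 := le_stable_tail_rpow hα1 hα2 hX (y := y) (by nlinarith) hy1
    have ha : 0 < 1 / y ^ α := by positivity
    have h2 : (10 : ℝ) ^ (-3 : ℤ) = 1 / 1000 := by norm_num
    rw [h2]
    linarith
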